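/- **Setting.** Let $(\Omega,\mathcal A)$ be a measurable space. A *Borel field of metric spaces* over $\Omega$ is a family $(X_\omega,d_\omega)_{\omega\in\Omega}$ of metric spaces with a set $\mathcal L(\Omega,X)\subseteq\prod_\omega X_\omega$ of *Borel sections* such that: (1) $\omega\mapsto d_\omega(x_\omega,y_\omega)$ is measurable for all $x,y\in\mathcal L(\Omega,X)$; (2) every $y\in\prod_\omega X_\omega$ for which $\omega\mapsto d_\omega(x_\omega,y_\omega)$ is measurable for all $x\in\mathcal L(\Omega,X)$ belongs to $\mathcal L(\Omega,X)$; (3) there is a sequence $(x^n)$ in $\mathcal L(\Omega,X)$ with $\{x^n_\omega\}_n$ dense in $X_\omega$ for every $\omega$. Assume that every $X_\omega$ is a proper unbounded CAT(0) space, and fix $x^0\in\mathcal L(\Omega,X)$. Let $\partial X_\omega$ be the set of asymptoticity classes of geodesic rays of $X_\omega$. For $x\in X_\omega$ and $\xi\in\partial X_\omega$ let $c_{x,\xi}$ be the geodesic ray from $x$ in the class $\xi$. The cone topology on $\partial X_\omega$ is the topology of pointwise convergence of the rays $c_{x^0_\omega,\xi}$. The Busemann function is $b_{x,\xi}(y)=\lim_{t\to\infty}\big(d(y,c_{x,\xi}(t))-d(x,c_{x,\xi}(t))\big)$.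 A section $\xi\in\prod_\omega\partial X_\omega$ is *Borel*, written $\xi\in\mathcal L(\Omega,\partial X)$, if $\omega\mapsto b_{x^0_\omega,\xi_\omega}(x_\omega)$ is measurable for every $x\in\mathcal L(\Omega,X)$. A family of subsets $A_\omega\subseteq\partial X_\omega$ is a *Borel subfield* if $\Omega'=\{\omega: A_\omega\neq\emptyset\}\in\mathcal A$ and there is a sequence $(y^n)$ in $\mathcal L(\Omega,\partial X)$ such that, for every $\omega\in\Omega'$, all $y^n_\omega$ lie in $A_\omega$ and $A_\omega\subseteq\overline{\{y^n_\omega\}_n}$ (closure in the cone topology). The angular metric on $\partial X_\omega$ is $\angle(\xi,\eta)=\sup_{x\in X_\omega}\angle_x(\xi,\eta)$, where $\angle_x(\xi,\eta)$ is the Alexandrov angle at $x$ between $c_{x,\xi}$ and $c_{x,\eta}$. For a non-empty set $A\subseteq\partial X_\omega$, its circumradius is $r(A)=\inf\{r>0:\exists\,\xi\in\partial X_\omega\ \forall\,\eta\in A,\ \angle(\xi,\eta)\le r\}$, and a circumcenter of $A$ is a point $\xi\in\partial X_\omega$ with $\angle(\xi,\eta)\le r(A)$ for all $\eta\in A$.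 **Theorem.** Let $(A_\omega)_{\omega\in\Omega}$ be a Borel subfield of $(\partial X_\omega)_{\omega\in\Omega}$ such that every $A_\omega$ is non-empty and closed in the cone topology. 1. The function $\omega\mapsto r(A_\omega)$ is measurable. 2. If moreover $r(A_\omega)<\pi/2$ for every $\omega\in\Omega$, then every $A_\omega$ has a unique circumcenter $c_{A_\omega}\in\partial X_\omega$, and the section $\omega\mapsto c_{A_\omega}$ is Borel, i.e. belongs to $\mathcal L(\Omega,\partial X)$. -/

import Mathlib

open Set Filter Topology
open scoped NNReal

noncomputable section

/-! ### Fields of metric spaces -/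

/-- A Borel structure on a field of metric spaces `X` over a Borel space `Ω`: a set `L` of sections
which is compatible with the metrics, maximal, and separable. -/
structure IsBorelStructure {Ω : Type*} [MeasurableSpace Ω] {X : Ω → Type*}
    [∀ ω, MetricSpace (X ω)] (L : Set (∀ ω, X ω)) : Prop where
  compatible : ∀ x ∈ L, ∀ y ∈ L, Measurable fun ω => dist (x ω) (y ω)
  maximal : ∀ y : ∀ ω, X ω, (∀ x ∈ L, Measurable fun ω => dist (x ω) (y ω)) → y ∈ L
  separable : ∃ D : ℕ → ∀ ω, X ω,
    (∀ n, D n ∈ L) ∧ ∀ ω, closure (range fun n => D n ω) = univ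

/-- A subfield `A` of a field of spaces `Y` (with topologies `τ` and set of Borel sections `L`) is
Borel if its base `{ω | A ω ≠ ∅}` is Borel and if there is a countable family of Borel sections,
lying in `A` over the base, whose values are dense in `A ω` for every `ω` in the base. -/
def IsBorelSubfield {Ω : Type*} [MeasurableSpace Ω] {Y : Ω → Type*}
    (τ : ∀ ω, TopologicalSpace (Y ω)) (L : Set (∀ ω, Y ω)) (A : ∀ ω, Set (Y ω)) : Prop :=
  MeasurableSet {ω | (A ω).Nonempty} ∧
    ∃ y : ℕ → ∀ ω, Y ω, (∀ n, y n ∈ L) ∧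
      ∀ ω, (A ω).Nonempty → (∀ n, y n ω ∈ A ω) ∧ A ω ⊆ closure[τ ω] (range fun n => y n ω)

/-! ### CAT(0) spaces -/

/-- `γ` restricted to `[a, b]` is a geodesic segment. -/
def IsGeodesicSegment {X : Type*} [MetricSpace X] (γ : ℝ → X) (a b : ℝ) : Prop :=
  a ≤ b ∧ ∀ s ∈ Icc a b, ∀ t ∈ Icc a b, dist (γ s) (γ t) = |s - t|

/-- Every two points are joined by a geodesic, and every geodesic triangle is at least as thin as
its Euclidean comparison triangle: the distance from a vertex `z` to a point `q` of the opposite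
side `[x, y]` is at most the corresponding distance in the comparison triangle. -/
def IsCAT0 (X : Type*) [MetricSpace X] : Prop :=
  (∀ x y : X, ∃ (γ : ℝ → X) (a b : ℝ), IsGeodesicSegment γ a b ∧ γ a = x ∧ γ b = y) ∧
  ∀ (x y z : X) (γ : ℝ → X) (a b : ℝ), IsGeodesicSegment γ a b → γ a = x → γ b = y →
    ∀ q ∈ γ '' Icc a b, ∀ x' y' z' : EuclideanSpace ℝ (Fin 2),
      dist x' y' = dist x y → dist x' z' = dist x z → dist y' z' = dist y z →
      ∀ q' ∈ segment ℝ x' y', dist x' q' = dist x q → dist z q ≤ dist z' q'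

/-! ### The boundary at infinity -/

/-- Geodesic rays `[0, ∞) → X`. -/
def GeodesicRay (X : Type*) [MetricSpace X] : Type _ := {c : ℝ≥0 → X // Isometry c}

/-- Two geodesic rays are asymptotic if they stay at bounded distance from each other. -/
def asymptoticSetoid (X : Type*) [MetricSpace X] : Setoid (GeodesicRay X) where
  r c c' := ∃ K : ℝ, ∀ t : ℝ≥0, dist (c.1 t) (c'.1 t) ≤ K
  iseqv :=
    { refl := fun c => ⟨0, fun t => by simp⟩
      symm := fun ⟨K, hK⟩ => ⟨K, fun t => by rw [dist_comm]; exact hK t⟩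
      trans := fun ⟨K, hK⟩ ⟨K', hK'⟩ =>
        ⟨K + K', fun t => (dist_triangle _ _ _).trans (add_le_add (hK t) (hK' t))⟩ }

/-- The boundary at infinity: asymptoticity classes of geodesic rays. -/
def Boundary (X : Type*) [MetricSpace X] : Type _ := Quotient (asymptoticSetoid X)

/-- The boundary point `c(∞)` of a geodesic ray `c`. -/
def GeodesicRay.endpoint {X : Type*} [MetricSpace X] (c : GeodesicRay X) : Boundary X :=
  Quotient.mk (asymptoticSetoid X) c

/-- The geodesic ray issuing from `x` in the class `ξ`. (It exists and is unique when `X` is a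
complete CAT(0) space.) -/
def rayFrom {X : Type*} [MetricSpace X] (x : X) (ξ : Boundary X) : GeodesicRay X :=
  @Classical.epsilon (GeodesicRay X) ⟨Quotient.out ξ⟩ fun c => c.1 0 = x ∧ c.endpoint = ξ

/-- The cone topology on the boundary, seen from `x₀`: points of the boundary are identified with
the geodesic rays issuing from `x₀`, with the topology of pointwise convergence. -/
@[reducible] def coneTopology {X : Type*} [MetricSpace X] (x₀ : X) : TopologicalSpace (Boundary X) :=
  TopologicalSpace.induced (fun (ξ : Boundary X) (t : ℝ≥0) => (rayFrom x₀ ξ).1 t) inferInstance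

/-- The Busemann function `b_{x₀, ξ}`. -/
def busemann {X : Type*} [MetricSpace X] (x₀ : X) (ξ : Boundary X) (x : X) : ℝ :=
  limUnder atTop fun t : ℝ≥0 => dist x ((rayFrom x₀ ξ).1 t) - dist x₀ ((rayFrom x₀ ξ).1 t)

/-- The Borel sections of the field of boundaries. Boundary points are identified with their
Busemann functions based at `x₀`, and a field of continuous functions is Borel if its evaluation
at every Borel section of the field `X` is a Borel function. -/
def boundarySections {Ω : Type*} [MeasurableSpace Ω] {X : Ω → Type*} [∀ ω, MetricSpace (X ω)]
    (L : Set (∀ ω, X ω)) (x₀ : ∀ ω, X ω) : Set (∀ ω, Boundary (X ω)) :=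
  {ξ | ∀ x ∈ L, Measurable fun ω => busemann (x₀ ω) (ξ ω) (x ω)}

/-! ### Angles -/

/-- The comparison angle at `p` between `x` and `y` (for `x ≠ p ≠ y`), by the law of cosines. -/
def comparisonAngle {X : Type*} [MetricSpace X] (p x y : X) : ℝ :=
  Real.arccos ((dist p x ^ 2 + dist p y ^ 2 - dist x y ^ 2) / (2 * dist p x * dist p y))

/-- The Alexandrov angle at `x` between two boundary points: the upper limit, as `t, t' → 0+`, of
the comparison angles at `x` of the points at times `t, t'` on the rays issuing from `x`. -/
def alexandrovAngle {X : Type*} [MetricSpace X] (x : X) (ξ η : Boundary X) : ℝ :=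
  limsup (fun q : ℝ≥0 × ℝ≥0 => comparisonAngle x ((rayFrom x ξ).1 q.1) ((rayFrom x η).1 q.2))
    (𝓝[>] 0 ×ˢ 𝓝[>] 0)

/-- The Tits angle (angular metric) on the boundary. -/
def titsAngle {X : Type*} [MetricSpace X] (ξ η : Boundary X) : ℝ :=
  ⨆ x : X, alexandrovAngle x ξ η

/-! ### Circumradius and circumcenters -/

/-- The circumradius of a set `A` of boundary points for the angular metric. -/
def circumradius {X : Type*} [MetricSpace X] (A : Set (Boundary X)) : ℝ :=
  sInf {r : ℝ | 0 < r ∧ ∃ ξ : Boundary X, ∀ η ∈ A, titsAngle ξ η ≤ r}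

/-- `ξ` is a circumcenter of `A` for the angular metric. -/
def IsCircumcenter {X : Type*} [MetricSpace X] (A : Set (Boundary X)) (ξ : Boundary X) : Prop :=
  ∀ η ∈ A, titsAngle ξ η ≤ circumradius A

end

/-! The angular metric is a supremum of angles over all of X, but it can be read from one base point
x: for 0 ≤ r ≤ π, ∠(ξ, η) ≤ r means that at every time t the points of the two rays from x have
comparison angle at most r, i.e. `2 cos r · t² ≤ gram x _ _` (`titsAngle_le_iff`). These are closed
conditions on distances, so they pass to limits of rays.

Circumcenters exist by compactness: in a proper space, points going to infinity which see A under
good cosines accumulate at a boundary point which does so too (`exists_boundary_tendsto`). They are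
unique because the midpoints between the rays to two of them keep the lower bound on the inner
products with the rays to A, while being closer to x by a definite factor, as distinct rays diverge
linearly. If cos r > 0 the cosines improve strictly, and a limit of the midpoints would be the
centre of a smaller ball containing A.

For measurability, the same compactness (`exists_boundary_iff`) reduces the existence of a boundary
point satisfying a cosine bound k with all members of a sequence, and whose ray passes near a given
point, to the existence, for each N, of two points of X satisfying finitely many distance
conditions. In a proper space this can be tested on a dense sequence. Rational radii q and k = cos q
(cut off at π) give the circumradius; k = cos r(A), together with uniqueness, locates the ray of the
circumcenter. Borel sections of the boundary are exactly those with Borel rays: a ray point is the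
only point of a ball with minimal Busemann value, and Busemann functions are limits of distances to
ray points. -/

/-! ### CAT(0) geometry -/

/-- Every triple of numbers satisfying the triangle inequalities is the triple of side lengths of
a triangle in the Euclidean plane, with a prescribed division point of one side. -/
theorem exists_comparison_triangle {l b c m : ℝ} (hl : 0 ≤ l) (hb : 0 ≤ b) (hc : 0 ≤ c)
    (h₁ : l ≤ b + c) (h₂ : b ≤ l + c) (h₃ : c ≤ l + b) (hm₀ : 0 ≤ m) (hm₁ : m ≤ 1) :
    ∃ x y z q : EuclideanSpace ℝ (Fin 2), dist x y = l ∧ dist x z = b ∧ dist y z = c ∧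
      q ∈ segment ℝ x y ∧ dist x q = m * l ∧
      dist z q ^ 2 = (1 - m) * b ^ 2 + m * c ^ 2 - m * (1 - m) * l ^ 2 := by
  obtain ⟨u, v, huv, hu⟩ : ∃ u v : ℝ, u ^ 2 + v ^ 2 = b ^ 2 ∧ 2 * l * u = b ^ 2 + l ^ 2 - c ^ 2 := by
    rcases hl.eq_or_lt with rfl | hl
    · exact ⟨b, 0, by ring, by rw [show b = c by linarith]; ring⟩
    · set u := (b ^ 2 + l ^ 2 - c ^ 2) / (2 * l)
      have hu : 2 * l * u = b ^ 2 + l ^ 2 - c ^ 2 := by simp only [u]; field_simp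
      have h4 : 0 ≤ (2 * l) ^ 2 * (b ^ 2 - u ^ 2) := by
        have : (2 * l) ^ 2 * (b ^ 2 - u ^ 2)
            = ((c - (l - b)) * (c + (l - b))) * ((b + l - c) * (b + l + c)) := by
          rw [mul_sub, ← mul_pow (2 * l) u, hu]; ring
        rw [this]
        apply mul_nonneg <;> apply mul_nonneg <;> linarith
      have h5 : 0 ≤ b ^ 2 - u ^ 2 := nonneg_of_mul_nonneg_right h4 (by positivity)
      exact ⟨u, √(b ^ 2 - u ^ 2), by rw [Real.sq_sqrt h5]; ring, hu⟩
  refine ⟨!₂[0, 0], !₂[l, 0], !₂[u, v], !₂[m * l, 0], ?_, ?_, ?_, ?_, ?_, ?_⟩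
  · simp [EuclideanSpace.dist_eq, Real.dist_eq, Real.sqrt_sq hl]
  · simp [EuclideanSpace.dist_eq, Real.dist_eq, huv, hb]
  · rw [EuclideanSpace.dist_eq, Real.sqrt_eq_iff_mul_self_eq (by positivity) hc]
    simp [Real.dist_eq]
    nlinarith
  · refine ⟨1 - m, m, by linarith, hm₀, by ring, ?_⟩
    ext i; fin_cases i <;> simp
  · simp [EuclideanSpace.dist_eq, Real.dist_eq, Real.sqrt_sq (mul_nonneg hm₀ hl)]
  · rw [EuclideanSpace.dist_eq, Real.sq_sqrt (by positivity)]
    simp [Real.dist_eq]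
    linear_combination huv - m * hu

section Geometry

variable {X : Type*} [MetricSpace X]

/-- Points of a CAT(0) space are joined by geodesics parametrized by arc length from `0`. -/
theorem IsCAT0.exists_geodesic (hX : IsCAT0 X) (x y : X) :
    ∃ γ : ℝ → X, IsGeodesicSegment γ 0 (dist x y) ∧ γ 0 = x ∧ γ (dist x y) = y := by
  obtain ⟨γ, a, b, ⟨hab, hγ⟩, rfl, rfl⟩ := hX.1 x y
  have hd : dist (γ a) (γ b) = b - a := by
    rw [hγ a ⟨le_rfl, hab⟩ b ⟨hab, le_rfl⟩, abs_sub_comm, abs_of_nonneg (by linarith)]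
  refine ⟨fun t => γ (a + t), ⟨dist_nonneg, fun s hs t ht => ?_⟩, by simp, by simp [hd]⟩
  rw [hd] at hs ht
  rw [hγ _ ⟨by linarith [hs.1], by linarith [hs.2]⟩ _ ⟨by linarith [ht.1], by linarith [ht.2]⟩]
  congr 1; ring

/-- A chosen geodesic from `x` to `y`, parametrized by arc length on `[0, dist x y]`. -/
noncomputable def IsCAT0.geodesic (hX : IsCAT0 X) (x y : X) : ℝ → X :=
  (hX.exists_geodesic x y).choose

theorem IsCAT0.geodesic_dist (hX : IsCAT0 X) (x y : X) {s t : ℝ} (hs : s ∈ Icc 0 (dist x y))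
    (ht : t ∈ Icc 0 (dist x y)) : dist (hX.geodesic x y s) (hX.geodesic x y t) = |s - t| :=
  (hX.exists_geodesic x y).choose_spec.1.2 s hs t ht

theorem IsCAT0.geodesic_zero (hX : IsCAT0 X) (x y : X) : hX.geodesic x y 0 = x :=
  (hX.exists_geodesic x y).choose_spec.2.1

theorem IsCAT0.geodesic_one (hX : IsCAT0 X) (x y : X) : hX.geodesic x y (dist x y) = y :=
  (hX.exists_geodesic x y).choose_spec.2.2

theorem IsCAT0.dist_geodesic_left (hX : IsCAT0 X) (x y : X) {t : ℝ} (ht : t ∈ Icc 0 (dist x y)) :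
    dist x (hX.geodesic x y t) = t := by
  have := hX.geodesic_dist x y (s := 0) ⟨le_rfl, dist_nonneg⟩ ht
  rwa [hX.geodesic_zero, zero_sub, abs_neg, abs_of_nonneg ht.1] at this

theorem IsCAT0.dist_geodesic_right (hX : IsCAT0 X) (x y : X) {t : ℝ}
    (ht : t ∈ Icc 0 (dist x y)) : dist (hX.geodesic x y t) y = dist x y - t := by
  have := hX.geodesic_dist x y ht (t := dist x y) ⟨dist_nonneg, le_rfl⟩
  rwa [hX.geodesic_one, abs_sub_comm, abs_of_nonneg (by linarith [ht.2])] at this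

/-- `q` divides the segment from `x` to `y` in the proportion `m : 1 - m`. -/
structure IsDivisionPoint (m : ℝ) (x y q : X) : Prop where
  nonneg : 0 ≤ m
  le_one : m ≤ 1
  left : dist x q = m * dist x y
  right : dist q y = (1 - m) * dist x y

theorem IsCAT0.isDivisionPoint_geodesic (hX : IsCAT0 X) (x y : X) {m : ℝ} (h₀ : 0 ≤ m)
    (h₁ : m ≤ 1) : IsDivisionPoint m x y (hX.geodesic x y (m * dist x y)) := by
  have h : m * dist x y ∈ Icc 0 (dist x y) :=
    ⟨by positivity, mul_le_of_le_one_left dist_nonneg h₁⟩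
  exact ⟨h₀, h₁, hX.dist_geodesic_left x y h, by rw [hX.dist_geodesic_right x y h]; ring⟩

theorem IsDivisionPoint.of_dist {x y q : X} {t : ℝ} (ht : 0 ≤ t) (hty : t ≤ dist x y)
    (h₁ : dist x q = t) (h₂ : dist q y = dist x y - t) :
    IsDivisionPoint (t / dist x y) x y q := by
  -- If `dist x y = 0`, then `t = 0` and the proportion takes the default value `0 / 0 = 0`.
  rcases (dist_nonneg : 0 ≤ dist x y).eq_or_lt with h | h
  · have : t = 0 := by linarith
    subst this
    exact ⟨by simp, by simp, by simp [h₁], by simp [h₂]⟩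
  · exact ⟨by positivity, (div_le_one h).2 hty, by rw [h₁]; field_simp, by rw [h₂]; field_simp⟩

/-- The CAT(0) inequality for the chosen geodesics, in the form of Stewart's theorem. -/
theorem IsCAT0.dist_geodesic_sq_le (hX : IsCAT0 X) (x y z : X) {m : ℝ} (h₀ : 0 ≤ m)
    (h₁ : m ≤ 1) :
    dist z (hX.geodesic x y (m * dist x y)) ^ 2 ≤
      (1 - m) * dist z x ^ 2 + m * dist z y ^ 2 - m * (1 - m) * dist x y ^ 2 := by
  have h : m * dist x y ∈ Icc 0 (dist x y) :=
    ⟨by positivity, mul_le_of_le_one_left dist_nonneg h₁⟩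
  obtain ⟨x', y', z', q', hxy, hxz, hyz, hq, hxq, hzq⟩ :=
    exists_comparison_triangle (l := dist x y) (b := dist x z) (c := dist y z) dist_nonneg
      dist_nonneg dist_nonneg (by rw [dist_comm y z]; exact dist_triangle _ _ _)
      (dist_triangle _ _ _) (by rw [dist_comm x y]; exact dist_triangle _ _ _) h₀ h₁
  have := hX.2 x y z (hX.geodesic x y) 0 (dist x y) (hX.exists_geodesic x y).choose_spec.1
    (hX.geodesic_zero x y) (hX.geodesic_one x y) _ ⟨_, h, rfl⟩ x' y' z' hxy hxz hyz q' hq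
    (by rw [hxq, hX.dist_geodesic_left x y h])
  rw [dist_comm z x, dist_comm z y, ← hzq]
  gcongr

/-- Stewart's inequality at `z = q` has right-hand side zero, since (1 - m)m² + m(1 - m)² = m(1 -
m). Hence two distances determine a division point. -/
theorem IsDivisionPoint.eq_geodesic (hX : IsCAT0 X) {x y q : X} {m : ℝ}
    (h : IsDivisionPoint m x y q) : q = hX.geodesic x y (m * dist x y) := by
  have := hX.dist_geodesic_sq_le x y q h.nonneg h.le_one
  rw [dist_comm q x, h.left, h.right] at this
  have h2 : dist q (hX.geodesic x y (m * dist x y)) ^ 2 ≤ 0 := by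
    refine this.trans (le_of_eq ?_); ring
  exact dist_eq_zero.1 (pow_eq_zero_iff two_ne_zero |>.1 (le_antisymm h2 (by positivity)))

theorem IsDivisionPoint.dist_sq_le (hX : IsCAT0 X) {x y q : X} {m : ℝ}
    (h : IsDivisionPoint m x y q) (z : X) :
    dist z q ^ 2 ≤
      (1 - m) * dist z x ^ 2 + m * dist z y ^ 2 - m * (1 - m) * dist x y ^ 2 := by
  rw [h.eq_geodesic hX]
  exact hX.dist_geodesic_sq_le x y z h.nonneg h.le_one

/-- The square of the right-hand side exceeds Stewart's bound by m(1 - m)(d(x,y)² - (d(z,x) -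
d(z,y))²), which is nonnegative. -/
theorem IsDivisionPoint.dist_le (hX : IsCAT0 X) {x y q : X} {m : ℝ}
    (h : IsDivisionPoint m x y q) (z : X) :
    dist z q ≤ (1 - m) * dist z x + m * dist z y := by
  have h1 := h.dist_sq_le hX z
  have h0 := h.nonneg
  have h0' : 0 ≤ 1 - m := sub_nonneg.2 h.le_one
  have h2 : (dist z x - dist z y) ^ 2 ≤ dist x y ^ 2 := by
    apply sq_le_sq.2
    rw [abs_of_nonneg (dist_nonneg : 0 ≤ dist x y), dist_comm z x, dist_comm z y]
    exact abs_dist_sub_le x y z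
  have h3 : 0 ≤ m * (1 - m) * (dist x y ^ 2 - (dist z x - dist z y) ^ 2) :=
    mul_nonneg (mul_nonneg h0 h0') (sub_nonneg.2 h2)
  refine le_of_sq_le_sq ?_ (by positivity)
  nlinarith

/-- Twice the inner product, seen from `p`, of the points `a` and `b` of a comparison triangle. -/
def gram (p a b : X) : ℝ := dist p a ^ 2 + dist p b ^ 2 - dist a b ^ 2

theorem gram_comm (p a b : X) : gram p a b = gram p b a := by
  simp only [gram, dist_comm a b]; ring

theorem gram_le (p a b : X) : gram p a b ≤ 2 * dist p a * dist p b := by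
  have : (dist p a - dist p b) ^ 2 ≤ dist a b ^ 2 := by
    apply sq_le_sq.2
    rw [abs_of_nonneg (dist_nonneg : 0 ≤ dist a b), dist_comm p a, dist_comm p b]
    exact abs_dist_sub_le a b p
  simp only [gram]; nlinarith

theorem le_gram (p a b : X) : -(2 * dist p a * dist p b) ≤ gram p a b := by
  have h := dist_triangle_left a b p
  have : dist a b ^ 2 ≤ (dist p a + dist p b) ^ 2 := by gcongr
  simp only [gram]; nlinarith

theorem comparisonAngle_eq (p a b : X) :
    comparisonAngle p a b = Real.arccos (gram p a b / (2 * dist p a * dist p b)) := rfl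

/-- Stewart's inequality rearranged. It is the monotonicity of comparison angles, free of division:
sliding a point towards `p` can only increase the cosine at `p`. -/
theorem IsDivisionPoint.mul_gram_le (hX : IsCAT0 X) {p a a' : X} {m : ℝ}
    (h : IsDivisionPoint m p a a') (b : X) : m * gram p a b ≤ gram p a' b := by
  have h1 := h.dist_sq_le hX b
  simp only [gram, h.left]
  rw [dist_comm b a', dist_comm b p, dist_comm b a] at h1
  nlinarith

theorem IsDivisionPoint.mul_mul_gram_le (hX : IsCAT0 X) {p a a' b b' : X} {m n : ℝ}
    (h : IsDivisionPoint m p a a') (h' : IsDivisionPoint n p b b') :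
    m * n * gram p a b ≤ gram p a' b' := by
  have h1 := h.mul_gram_le hX b'
  have h2 := h'.mul_gram_le hX a
  rw [gram_comm p b a, gram_comm p b' a] at h2
  calc m * n * gram p a b = m * (n * gram p a b) := by ring
    _ ≤ m * gram p a b' := by gcongr; exact h.nonneg
    _ ≤ _ := h1

theorem IsDivisionPoint.dist_le_mul (hX : IsCAT0 X) {p a a' b b' : X} {m : ℝ}
    (h : IsDivisionPoint m p a a') (h' : IsDivisionPoint m p b b') :
    dist a' b' ≤ m * dist a b := by
  have h1 := h.mul_mul_gram_le hX h'
  simp only [gram, h.left, h'.left] at h1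
  refine le_of_sq_le_sq ?_ (mul_nonneg h.nonneg dist_nonneg)
  nlinarith

/-! ### Geodesic rays -/

theorem GeodesicRay.dist_eq (c : GeodesicRay X) (s t : ℝ≥0) :
    dist (c.1 s) (c.1 t) = |(s : ℝ) - t| := by
  rw [c.2.dist_eq, NNReal.dist_eq]

theorem GeodesicRay.dist_zero (c : GeodesicRay X) (t : ℝ≥0) : dist (c.1 0) (c.1 t) = t := by
  simp [c.dist_eq]

theorem GeodesicRay.isDivisionPoint (c : GeodesicRay X) {u s t : ℝ≥0} (hus : u ≤ s) (hst : s ≤ t) :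
    IsDivisionPoint (((s : ℝ) - u) / (t - u)) (c.1 u) (c.1 t) (c.1 s) := by
  have h1 : (u : ℝ) ≤ s := hus
  have h2 : (s : ℝ) ≤ t := hst
  have h3 : dist (c.1 u) (c.1 t) = t - u := by
    rw [c.dist_eq, abs_sub_comm, abs_of_nonneg (by linarith)]
  rw [← h3]
  apply IsDivisionPoint.of_dist
  · linarith
  · linarith
  · rw [c.dist_eq, abs_sub_comm, abs_of_nonneg (by linarith)]
  · rw [c.dist_eq, abs_sub_comm, abs_of_nonneg (by linarith), h3]; ring

theorem GeodesicRay.isDivisionPoint_zero (c : GeodesicRay X) {s t : ℝ≥0} (hst : s ≤ t) :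
    IsDivisionPoint ((s : ℝ) / t) (c.1 0) (c.1 t) (c.1 s) := by
  simpa using c.isDivisionPoint (zero_le (a := s)) hst

theorem GeodesicRay.mul_dist_le (hX : IsCAT0 X) {c c' : GeodesicRay X} (h : c.1 0 = c'.1 0)
    {s t : ℝ≥0} (hst : s ≤ t) : t * dist (c.1 s) (c'.1 s) ≤ s * dist (c.1 t) (c'.1 t) := by
  have h1 := c.isDivisionPoint_zero hst
  have h2 := c'.isDivisionPoint_zero hst
  rw [← h] at h2
  have h3 := h1.dist_le_mul hX h2
  rcases (zero_le (a := t)).eq_or_lt with rfl | ht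
  · have : s = 0 := le_antisymm hst (zero_le)
    simp [this]
  · have ht' : (0 : ℝ) < t := ht
    rw [div_mul_eq_mul_div, le_div_iff₀ ht'] at h3
    linarith

/-- By `mul_dist_le` the distance at time t divided by t is nondecreasing, so distinct rays from one
point diverge linearly. -/
theorem GeodesicRay.eq_of_asymptotic (hX : IsCAT0 X) {c c' : GeodesicRay X}
    (h : c.1 0 = c'.1 0) (he : c.endpoint = c'.endpoint) : c = c' := by
  obtain ⟨K, hK⟩ : ∃ K : ℝ, ∀ t : ℝ≥0, dist (c.1 t) (c'.1 t) ≤ K := Quotient.exact he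
  apply Subtype.ext
  funext s
  by_contra hne
  have hd : 0 < dist (c.1 s) (c'.1 s) := dist_pos.2 hne
  obtain ⟨n, hn⟩ := exists_nat_gt ((s * K) / dist (c.1 s) (c'.1 s))
  rw [div_lt_iff₀ hd] at hn
  have h1 := GeodesicRay.mul_dist_le hX h (s := s) (t := s + n) (by simp)
  have h2 := hK (s + n)
  have h3 : (s : ℝ) * dist (c.1 (s + n)) (c'.1 (s + n)) ≤ s * K := by gcongr
  push_cast at h1
  have h4 : 0 ≤ (s : ℝ) * dist (c.1 s) (c'.1 s) := by positivity
  nlinarith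

/-- In a proper CAT(0) space, geodesics from `x` to points going to infinity converge, along an
ultrafilter, to a geodesic ray. -/
theorem IsCAT0.exists_ray_tendsto [ProperSpace X] (hX : IsCAT0 X) (x : X) {ι : Type*}
    (U : Ultrafilter ι) (z : ι → X) (hz : Tendsto (fun i => dist x (z i)) U atTop) :
    ∃ c : GeodesicRay X, c.1 0 = x ∧
      ∀ t : ℝ≥0, Tendsto (fun i => hX.geodesic x (z i) t) U (𝓝 (c.1 t)) := by
  have hev : ∀ t : ℝ≥0, ∀ᶠ i in (U : Filter ι), (t : ℝ) ∈ Icc 0 (dist x (z i)) := fun t => by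
    filter_upwards [hz.eventually_ge_atTop (t : ℝ)] with i hi using ⟨t.coe_nonneg, hi⟩
  have hlim : ∀ t : ℝ≥0, ∃ y, Tendsto (fun i => hX.geodesic x (z i) t) U (𝓝 y) := fun t => by
    have hK := (isCompact_closedBall x (t : ℝ)).ultrafilter_le_nhds
      (U.map fun i => hX.geodesic x (z i) t) (by
        rw [Ultrafilter.coe_map, le_principal_iff, mem_map]
        filter_upwards [hev t] with i hi
        rw [mem_preimage, Metric.mem_closedBall, dist_comm, hX.dist_geodesic_left x _ hi])
    obtain ⟨y, -, hy⟩ := hK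
    exact ⟨y, hy⟩
  choose c hc using hlim
  refine ⟨⟨c, Isometry.of_dist_eq fun s t => ?_⟩, ?_, hc⟩
  · refine tendsto_nhds_unique ((hc s).dist (hc t)) (tendsto_const_nhds.congr' ?_)
    filter_upwards [hev s, hev t] with i hs ht
    rw [hX.geodesic_dist x _ hs ht, NNReal.dist_eq]
  · refine tendsto_nhds_unique (hc 0) (tendsto_const_nhds.congr fun i => ?_)
    simp [hX.geodesic_zero]

theorem IsCAT0.exists_asymptotic_ray [ProperSpace X] (hX : IsCAT0 X) (x : X)
    (c : GeodesicRay X) (U : Ultrafilter ℝ≥0) (hU : (U : Filter ℝ≥0) ≤ atTop) :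
    ∃ c' : GeodesicRay X, c'.1 0 = x ∧ c'.endpoint = c.endpoint ∧
      ∀ t : ℝ≥0, Tendsto (fun s => hX.geodesic x (c.1 s) t) U (𝓝 (c'.1 t)) := by
  have hbd : ∀ s : ℝ≥0, |dist x (c.1 s) - s| ≤ dist x (c.1 0) := fun s => by
    have := abs_dist_sub_le x (c.1 0) (c.1 s)
    rwa [c.dist_zero] at this
  have htop : Tendsto (fun s : ℝ≥0 => dist x (c.1 s)) atTop atTop := by
    refine tendsto_atTop_mono (f := fun s : ℝ≥0 => (s : ℝ) - dist x (c.1 0)) (fun s => ?_) ?_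
    · linarith [(abs_le.1 (hbd s)).1]
    · exact tendsto_atTop_add_const_right _ _ (NNReal.tendsto_coe_atTop.2 tendsto_id)
  obtain ⟨c', h0, hc'⟩ := hX.exists_ray_tendsto x U (fun s => c.1 s) (htop.mono_left hU)
  refine ⟨c', h0, Quotient.sound ⟨2 * dist x (c.1 0), fun t => ?_⟩, hc'⟩
  refine le_of_tendsto ((hc' t).dist tendsto_const_nhds) ?_
  filter_upwards [(htop.mono_left hU).eventually_ge_atTop (t : ℝ),
    hU (eventually_ge_atTop t), hU (eventually_gt_atTop 0)] with s hs hst hs0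
  have hs0' : (0 : ℝ) < s := hs0
  have hst' : (t : ℝ) ≤ s := hst
  set l := dist x (c.1 s) with hl
  have hm : (t : ℝ) / s ∈ Icc (0 : ℝ) 1 := ⟨by positivity, (div_le_one hs0').2 hst'⟩
  -- Compare points in the same proportion on the two sides of the triangle with apex `c.1 s`.
  have hdiv : dist (hX.geodesic x (c.1 s) ((t : ℝ) / s * l)) (c.1 t) ≤ dist x (c.1 0) := by
    have h1 := hX.isDivisionPoint_geodesic x (c.1 s) hm.1 hm.2
    have h2 := c.isDivisionPoint_zero hst
    have h1' : IsDivisionPoint (1 - (t : ℝ) / s) (c.1 s) x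
        (hX.geodesic x (c.1 s) ((t : ℝ) / s * l)) :=
      ⟨by linarith [hm.2], by linarith [hm.1], by rw [dist_comm, h1.right, dist_comm x],
        by rw [dist_comm, h1.left, dist_comm x]; ring⟩
    have h2' : IsDivisionPoint (1 - (t : ℝ) / s) (c.1 s) (c.1 0) (c.1 t) :=
      ⟨by linarith [hm.2], by linarith [hm.1], by rw [dist_comm, h2.right, dist_comm (c.1 0)],
        by rw [dist_comm, h2.left, dist_comm (c.1 0)]; ring⟩
    refine (h1'.dist_le_mul hX h2').trans (mul_le_of_le_one_left dist_nonneg ?_)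
    linarith [hm.1]
  -- The two sides have lengths `l` and `s`, so passing from proportion `t / s` to time `t` costs at
  -- most |l - s|.
  have hpar : dist (hX.geodesic x (c.1 s) t) (hX.geodesic x (c.1 s) ((t : ℝ) / s * l))
      ≤ dist x (c.1 0) := by
    refine (hX.geodesic_dist x (c.1 s) ⟨t.coe_nonneg, hs⟩
      ⟨mul_nonneg hm.1 dist_nonneg, mul_le_of_le_one_left dist_nonneg hm.2⟩).trans_le ?_
    have : (t : ℝ) - t / s * l = -(t / s * (l - s)) := by field_simp; ring
    rw [← hl, this, abs_neg, abs_mul, abs_of_nonneg hm.1]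
    exact (mul_le_of_le_one_left (abs_nonneg _) hm.2).trans (hbd s)
  calc _ ≤ _ := dist_triangle _ (hX.geodesic x (c.1 s) ((t : ℝ) / s * l)) _
    _ ≤ _ := by linarith

theorem exists_ultrafilter_atTop : ∃ U : Ultrafilter ℝ≥0, (U : Filter ℝ≥0) ≤ atTop :=
  ⟨Ultrafilter.of atTop, Ultrafilter.of_le atTop⟩

theorem rayFrom_spec [ProperSpace X] (hX : IsCAT0 X) (x : X) (ξ : Boundary X) :
    (rayFrom x ξ).1 0 = x ∧ (rayFrom x ξ).endpoint = ξ := by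
  refine @Classical.epsilon_spec_aux (GeodesicRay X) ⟨Quotient.out ξ⟩
    (fun c => c.1 0 = x ∧ c.endpoint = ξ) ?_
  obtain ⟨U, hU⟩ := exists_ultrafilter_atTop
  obtain ⟨c', h0, he, -⟩ := hX.exists_asymptotic_ray x (Quotient.out ξ) U hU
  exact ⟨c', h0, he.trans (Quotient.out_eq ξ)⟩

theorem rayFrom_zero [ProperSpace X] (hX : IsCAT0 X) (x : X) (ξ : Boundary X) :
    (rayFrom x ξ).1 0 = x := (rayFrom_spec hX x ξ).1

theorem endpoint_rayFrom [ProperSpace X] (hX : IsCAT0 X) (x : X) (ξ : Boundary X) :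
    (rayFrom x ξ).endpoint = ξ := (rayFrom_spec hX x ξ).2

theorem rayFrom_eq [ProperSpace X] (hX : IsCAT0 X) {x : X} {ξ : Boundary X} {c : GeodesicRay X}
    (h0 : c.1 0 = x) (he : c.endpoint = ξ) : rayFrom x ξ = c :=
  GeodesicRay.eq_of_asymptotic hX ((rayFrom_zero hX x ξ).trans h0.symm)
    ((endpoint_rayFrom hX x ξ).trans he.symm)

theorem dist_rayFrom [ProperSpace X] (hX : IsCAT0 X) (x : X) (ξ : Boundary X) (t : ℝ≥0) :
    dist x ((rayFrom x ξ).1 t) = t := by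
  have := (rayFrom x ξ).dist_zero t
  rwa [rayFrom_zero hX] at this

/-- The ray from `x` to `ξ` is the limit of the geodesics from `x` to the points of any ray
towards `ξ`. -/
theorem tendsto_geodesic_rayFrom [ProperSpace X] (hX : IsCAT0 X) (x : X) (c : GeodesicRay X)
    {U : Ultrafilter ℝ≥0} (hU : (U : Filter ℝ≥0) ≤ atTop) (t : ℝ≥0) :
    Tendsto (fun s => hX.geodesic x (c.1 s) t) U (𝓝 ((rayFrom x c.endpoint).1 t)) := by
  obtain ⟨c', h0, he, h⟩ := hX.exists_asymptotic_ray x c U hU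
  rw [rayFrom_eq hX h0 he]
  exact h t

/-- The tail of a geodesic ray. -/
def GeodesicRay.tail (c : GeodesicRay X) (u : ℝ≥0) : GeodesicRay X :=
  ⟨fun t => c.1 (u + t), Isometry.of_dist_eq fun s t => by
    rw [c.2.dist_eq, NNReal.dist_eq, NNReal.dist_eq]; push_cast; congr 1; ring⟩

theorem GeodesicRay.endpoint_tail (c : GeodesicRay X) (u : ℝ≥0) :
    (c.tail u).endpoint = c.endpoint :=
  Quotient.sound ⟨u, fun t => by simp [GeodesicRay.tail, c.dist_eq]⟩

theorem rayFrom_rayFrom [ProperSpace X] (hX : IsCAT0 X) (x : X) (ξ : Boundary X) (u : ℝ≥0) :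
    rayFrom ((rayFrom x ξ).1 u) ξ = (rayFrom x ξ).tail u :=
  rayFrom_eq hX (by simp [GeodesicRay.tail])
    (by rw [GeodesicRay.endpoint_tail, endpoint_rayFrom hX])

/-! ### Busemann functions -/

/-- By the triangle inequality the function of t is nonincreasing and bounded below, so the
`limUnder` in `busemann` is a genuine limit. -/
theorem tendsto_busemann [ProperSpace X] (hX : IsCAT0 X) (x₀ : X) (ξ : Boundary X) (x : X) :
    Tendsto (fun t : ℝ≥0 => dist x ((rayFrom x₀ ξ).1 t) - t) atTop (𝓝 (busemann x₀ ξ x)) := by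
  have hlim : ∃ l, Tendsto (fun t : ℝ≥0 => dist x ((rayFrom x₀ ξ).1 t) - t) atTop (𝓝 l) := by
    refine ⟨_, tendsto_atTop_ciInf (fun s t hst => ?_) ⟨-dist x x₀, ?_⟩⟩
    · have h := dist_triangle x ((rayFrom x₀ ξ).1 s) ((rayFrom x₀ ξ).1 t)
      have hst' : (s : ℝ) ≤ t := hst
      rw [GeodesicRay.dist_eq, abs_sub_comm, abs_of_nonneg (by linarith)] at h
      linarith
    · rintro _ ⟨t, rfl⟩
      have h := dist_triangle_left x₀ ((rayFrom x₀ ξ).1 t) x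
      rw [dist_rayFrom hX] at h
      simp only; linarith
  have h : busemann x₀ ξ x = limUnder atTop fun t : ℝ≥0 => dist x ((rayFrom x₀ ξ).1 t) - t :=
    congrArg (limUnder atTop) (funext fun t => by rw [dist_rayFrom hX])
  rw [h]
  exact tendsto_nhds_limUnder hlim

theorem busemann_sub_le [ProperSpace X] (hX : IsCAT0 X) (x₀ : X) (ξ : Boundary X) (x y : X) :
    busemann x₀ ξ x - busemann x₀ ξ y ≤ dist x y := by
  refine le_of_tendsto ((tendsto_busemann hX x₀ ξ x).sub (tendsto_busemann hX x₀ ξ y))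
    (Eventually.of_forall fun t => ?_)
  linarith [dist_triangle x y ((rayFrom x₀ ξ).1 t)]

theorem busemann_base [ProperSpace X] (hX : IsCAT0 X) (x₀ : X) (ξ : Boundary X) :
    busemann x₀ ξ x₀ = 0 :=
  tendsto_nhds_unique (tendsto_busemann hX x₀ ξ x₀)
    (tendsto_const_nhds.congr fun t => by rw [dist_rayFrom hX, sub_self])

theorem neg_dist_le_busemann [ProperSpace X] (hX : IsCAT0 X) (x₀ : X) (ξ : Boundary X) (x : X) :
    -dist x₀ x ≤ busemann x₀ ξ x := by
  have := busemann_sub_le hX x₀ ξ x₀ x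
  rw [busemann_base hX] at this
  linarith

theorem busemann_ray [ProperSpace X] (hX : IsCAT0 X) (x₀ : X) (ξ : Boundary X) (s : ℝ≥0) :
    busemann x₀ ξ ((rayFrom x₀ ξ).1 s) = -s := by
  refine tendsto_nhds_unique (tendsto_busemann hX x₀ ξ _) (tendsto_const_nhds.congr' ?_)
  filter_upwards [eventually_ge_atTop s] with t ht
  have ht' : (s : ℝ) ≤ t := ht
  rw [GeodesicRay.dist_eq, abs_sub_comm, abs_of_nonneg (by linarith)]
  ring

theorem continuous_busemann [ProperSpace X] (hX : IsCAT0 X) (x₀ : X) (ξ : Boundary X) :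
    Continuous (busemann x₀ ξ) := by
  refine (LipschitzWith.of_dist_le_mul (K := 1) fun x y => ?_).continuous
  rw [NNReal.coe_one, one_mul, Real.dist_eq, abs_le]
  have h1 := busemann_sub_le hX x₀ ξ x y
  have h2 := busemann_sub_le hX x₀ ξ y x
  rw [dist_comm] at h2
  constructor <;> linarith

theorem IsDivisionPoint.busemann_le [ProperSpace X] (hX : IsCAT0 X) (x₀ : X) (ξ : Boundary X)
    {x y q : X} {m : ℝ} (h : IsDivisionPoint m x y q) :
    busemann x₀ ξ q ≤ (1 - m) * busemann x₀ ξ x + m * busemann x₀ ξ y := by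
  refine le_of_tendsto_of_tendsto' (tendsto_busemann hX x₀ ξ q)
    (((tendsto_busemann hX x₀ ξ x).const_mul _).add ((tendsto_busemann hX x₀ ξ y).const_mul _))
    fun t => ?_
  have := h.dist_le hX ((rayFrom x₀ ξ).1 t)
  simp only [dist_comm ((rayFrom x₀ ξ).1 t)] at this
  linarith

end Geometry

/-! ### The angular metric -/

section Angles

variable {X : Type*} [MetricSpace X]

theorem GeodesicRay.mul_mul_gram_le (hX : IsCAT0 X) {x : X} {c c' : GeodesicRay X}
    (h : c.1 0 = x) (h' : c'.1 0 = x) {s s' t t' : ℝ≥0} (hs : s ≤ t) (hs' : s' ≤ t') :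
    (s : ℝ) / t * (s' / t') * gram x (c.1 t) (c'.1 t') ≤ gram x (c.1 s) (c'.1 s') := by
  have h1 := c.isDivisionPoint_zero hs
  have h2 := c'.isDivisionPoint_zero hs'
  rw [h] at h1
  rw [h'] at h2
  exact h1.mul_mul_gram_le hX h2

/-- A lower bound, uniform in `t`, of the cosines of the comparison angles at `x` of the points at
time `t` on two rays bounds the comparison angles of all points of these rays. -/
theorem GeodesicRay.le_gram_of_forall (hX : IsCAT0 X) {x : X} {c c' : GeodesicRay X}
    (h : c.1 0 = x) (h' : c'.1 0 = x) {k : ℝ}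
    (hk : ∀ t : ℝ≥0, 2 * k * (t : ℝ) ^ 2 ≤ gram x (c.1 t) (c'.1 t)) (s t : ℝ≥0) :
    2 * k * s * t ≤ gram x (c.1 s) (c'.1 t) := by
  have h1 := GeodesicRay.mul_mul_gram_le hX h h' (le_max_left s t) (le_max_right s t)
  rcases (zero_le (a := max s t)).eq_or_lt with h0 | h0
  · have hs : s = 0 := le_antisymm (h0 ▸ le_max_left s t) zero_le
    have ht : t = 0 := le_antisymm (h0 ▸ le_max_right s t) zero_le
    simpa [hs, ht, h, h'] using hk 0
  · refine le_trans ?_ h1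
    have h0' : (0 : ℝ) < (max s t : ℝ≥0) := h0
    calc 2 * k * s * t
        = (s : ℝ) / (max s t : ℝ≥0) * (t / (max s t : ℝ≥0)) *
          (2 * k * ((max s t : ℝ≥0) : ℝ) ^ 2) := by field_simp
      _ ≤ _ := by gcongr; exact hk _

theorem comparisonAngle_mem (p a b : X) : comparisonAngle p a b ∈ Icc 0 Real.pi :=
  ⟨Real.arccos_nonneg _, Real.arccos_le_pi _⟩

theorem eventually_pos_prod :
    ∀ᶠ q : ℝ≥0 × ℝ≥0 in 𝓝[>] 0 ×ˢ 𝓝[>] 0, 0 < q.1 ∧ 0 < q.2 := by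
  have h : ∀ᶠ s : ℝ≥0 in 𝓝[>] 0, 0 < s := self_mem_nhdsWithin
  exact h.prod_mk h

theorem isBoundedUnder_comparisonAngle (x : X) (c c' : GeodesicRay X) (f : Filter (ℝ≥0 × ℝ≥0)) :
    f.IsBoundedUnder (· ≤ ·) fun q => comparisonAngle x (c.1 q.1) (c'.1 q.2) :=
  isBoundedUnder_of ⟨Real.pi, fun _ => (comparisonAngle_mem _ _ _).2⟩

theorem isCoboundedUnder_comparisonAngle (x : X) (c c' : GeodesicRay X) :
    (𝓝[>] (0 : ℝ≥0) ×ˢ 𝓝[>] (0 : ℝ≥0)).IsCoboundedUnder (· ≤ ·)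
      fun q => comparisonAngle x (c.1 q.1) (c'.1 q.2) :=
  IsBoundedUnder.isCoboundedUnder_le (isBoundedUnder_of ⟨0, fun _ => (comparisonAngle_mem _ _ _).1⟩)

theorem alexandrovAngle_le_pi (x : X) (ξ η : Boundary X) : alexandrovAngle x ξ η ≤ Real.pi :=
  limsup_le_of_le (isCoboundedUnder_comparisonAngle _ _ _)
    (Eventually.of_forall fun _ => (comparisonAngle_mem _ _ _).2)

theorem alexandrovAngle_le_titsAngle (x : X) (ξ η : Boundary X) :
    alexandrovAngle x ξ η ≤ titsAngle ξ η :=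
  le_ciSup (f := fun x => alexandrovAngle x ξ η)
    ⟨Real.pi, by rintro _ ⟨y, rfl⟩; exact alexandrovAngle_le_pi y ξ η⟩ x

theorem tendsto_inv_succ_nhdsGT :
    Tendsto (fun n : ℕ => ((n : ℝ≥0) + 1)⁻¹) atTop (𝓝[>] 0) := by
  refine tendsto_nhdsWithin_iff.2 ⟨?_, Eventually.of_forall fun n => ?_⟩
  · rw [← NNReal.tendsto_coe]
    push_cast
    exact tendsto_inv_atTop_zero.comp
      (tendsto_atTop_add_const_right _ _ tendsto_natCast_atTop_atTop)
  · rw [mem_Ioi]; positivity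

/-- It is enough to bound the comparison angles from below along times `e` and `d` such that
`e / d` tends to `0`. -/
theorem arccos_le_alexandrovAngle {p : X} {ξ η : Boundary X} {k : ℝ}
    (hangle : ∀ e d : ℝ≥0, 0 < e → e ≤ d → Real.arccos (k + e / (2 * d)) ≤
      comparisonAngle p ((rayFrom p ξ).1 e) ((rayFrom p η).1 d)) :
    Real.arccos k ≤ alexandrovAngle p ξ η := by
  refine le_of_forall_lt fun b hb => ?_
  obtain ⟨b', hbb', hb'⟩ := exists_between hb
  refine hbb'.trans_le ?_
  -- Take d = 1/(n+1) and e = d²: both tend to 0+ and e/(2d) → 0. One such sequence suffices to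
  -- bound an upper limit from below.
  have hsq : Tendsto (fun n : ℕ => ((n : ℝ≥0) + 1)⁻¹ ^ 2) atTop (𝓝[>] 0) := by
    refine tendsto_nhdsWithin_iff.2 ⟨?_, Eventually.of_forall fun n => ?_⟩
    · have h := (tendsto_nhdsWithin_iff.1 tendsto_inv_succ_nhdsGT).1.pow 2
      rwa [zero_pow two_ne_zero] at h
    · rw [mem_Ioi]; positivity
  have hacos : Tendsto (fun n : ℕ => Real.arccos (k + ((n : ℝ) + 1)⁻¹ / 2)) atTop
      (𝓝 (Real.arccos k)) := by
    have h1 : Tendsto (fun n : ℕ => ((n : ℝ) + 1)⁻¹) atTop (𝓝 0) :=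
      tendsto_inv_atTop_zero.comp
        (tendsto_atTop_add_const_right _ _ tendsto_natCast_atTop_atTop)
    have h2 : Tendsto (fun n : ℕ => k + ((n : ℝ) + 1)⁻¹ / 2) atTop (𝓝 k) := by
      simpa using (h1.div_const 2).const_add k
    exact (Real.continuous_arccos.tendsto k).comp h2
  have hev : ∀ᶠ n : ℕ in atTop, b' ≤ comparisonAngle p
      ((rayFrom p ξ).1 (((n : ℝ≥0) + 1)⁻¹ ^ 2)) ((rayFrom p η).1 ((n : ℝ≥0) + 1)⁻¹) := by
    filter_upwards [hacos.eventually_const_lt hb'] with n hn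
    have hle : ((n : ℝ≥0) + 1)⁻¹ ≤ 1 := inv_le_one_of_one_le₀ (by simp)
    have := hangle (((n : ℝ≥0) + 1)⁻¹ ^ 2) ((n : ℝ≥0) + 1)⁻¹ (by positivity)
      (pow_le_of_le_one zero_le hle two_ne_zero)
    refine hn.le.trans (le_trans (le_of_eq ?_) this)
    congr 2
    push_cast
    field_simp
  exact le_limsup_of_frequently_le ((hsq.prodMk tendsto_inv_succ_nhdsGT).frequently
    hev.frequently) (isBoundedUnder_comparisonAngle _ _ _ _)

theorem titsAngle_le_pi [Nonempty X] (ξ η : Boundary X) : titsAngle ξ η ≤ Real.pi :=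
  ciSup_le fun x => alexandrovAngle_le_pi x ξ η

/-! ### The angular metric read from a single base point -/

variable [ProperSpace X] (hX : IsCAT0 X)

include hX

theorem asymptotic_rayFrom (x y : X) (ξ : Boundary X) :
    ∃ K : ℝ, ∀ t : ℝ≥0, dist ((rayFrom x ξ).1 t) ((rayFrom y ξ).1 t) ≤ K :=
  Quotient.exact ((endpoint_rayFrom hX x ξ).trans (endpoint_rayFrom hX y ξ).symm)

/-- The asymptotic bound for the distance of two rays does not depend on the base point. -/
theorem le_gram_rayFrom_of_le_gram {x : X} (y : X) {ξ η : Boundary X} {k : ℝ}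
    (hk : ∀ t : ℝ≥0, 2 * k * (t : ℝ) ^ 2 ≤ gram x ((rayFrom x ξ).1 t) ((rayFrom x η).1 t))
    (t : ℝ≥0) : 2 * k * (t : ℝ) ^ 2 ≤ gram y ((rayFrom y ξ).1 t) ((rayFrom y η).1 t) := by
  obtain ⟨K₁, hK₁⟩ := asymptotic_rayFrom hX x y ξ
  obtain ⟨K₂, hK₂⟩ := asymptotic_rayFrom hX x y η
  have hgram : ∀ (z : X) (s : ℝ≥0), gram z ((rayFrom z ξ).1 s) ((rayFrom z η).1 s) =
      2 * (s : ℝ) ^ 2 - dist ((rayFrom z ξ).1 s) ((rayFrom z η).1 s) ^ 2 := fun z s => by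
    rw [gram, dist_rayFrom hX, dist_rayFrom hX]; ring
  -- The inner product bound as a chord bound; √(2 - 2k) is the Euclidean chord of an angle with
  -- cosine `k`.
  have hk' : ∀ s : ℝ≥0, dist ((rayFrom x ξ).1 s) ((rayFrom x η).1 s) ≤ √(2 - 2 * k) * s := by
    intro s
    rcases (zero_le (a := s)).eq_or_lt with rfl | hs
    · simp [rayFrom_zero hX]
    have hs' : (0 : ℝ) < s := hs
    have h1 := hk s
    rw [hgram] at h1
    refine le_of_sq_le_sq ?_ (by positivity)
    have h2 : 0 ≤ (2 - 2 * k) * (s : ℝ) ^ 2 := by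
      have := sq_nonneg (dist ((rayFrom x ξ).1 s) ((rayFrom x η).1 s))
      nlinarith
    rw [mul_pow, Real.sq_sqrt (nonneg_of_mul_nonneg_left h2 (by positivity))]
    linarith
  -- Changing the base point costs a bounded error at the far time `s`; convexity brings it back to
  -- time `t` multiplied by t/s.
  have hbd : ∀ s : ℝ≥0, 0 < s → t ≤ s → dist ((rayFrom y ξ).1 t) ((rayFrom y η).1 t) ≤
      t * (√(2 - 2 * k) + (K₁ + K₂) * (s : ℝ)⁻¹) := by
    intro s hs hts
    have hs' : (0 : ℝ) < s := hs
    have h1 := GeodesicRay.mul_dist_le hX (c := rayFrom y ξ) (c' := rayFrom y η)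
      (by rw [rayFrom_zero hX, rayFrom_zero hX]) hts
    have h2 := dist_triangle4 ((rayFrom y ξ).1 s) ((rayFrom x ξ).1 s) ((rayFrom x η).1 s)
      ((rayFrom y η).1 s)
    have h3 := hK₁ s
    have h4 := hK₂ s
    have h5 := hk' s
    rw [dist_comm] at h3
    have h6 : (t : ℝ) * dist ((rayFrom y ξ).1 s) ((rayFrom y η).1 s) ≤
        t * (√(2 - 2 * k) * s + (K₁ + K₂)) := by
      gcongr; linarith
    refine le_of_mul_le_mul_left (h1.trans (h6.trans (le_of_eq ?_))) hs'
    field_simp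
  have hlim : dist ((rayFrom y ξ).1 t) ((rayFrom y η).1 t) ≤ t * √(2 - 2 * k) := by
    have h1 : Tendsto (fun s : ℝ≥0 => (t : ℝ) * (√(2 - 2 * k) + (K₁ + K₂) * (s : ℝ)⁻¹)) atTop
        (𝓝 (t * (√(2 - 2 * k) + (K₁ + K₂) * 0))) := by
      have := tendsto_inv_atTop_zero.comp (NNReal.tendsto_coe_atTop.2 (tendsto_id (x := atTop)))
      exact ((this.const_mul _).const_add _).const_mul _
    rw [mul_zero, add_zero] at h1
    refine ge_of_tendsto h1 ?_
    filter_upwards [eventually_gt_atTop 0, eventually_ge_atTop t] with s hs hts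
    exact hbd s hs hts
  have h2k : 0 ≤ 2 - 2 * k := by
    have h1 := hk 1
    rw [hgram] at h1
    have := sq_nonneg (dist ((rayFrom x ξ).1 1) ((rayFrom x η).1 1))
    push_cast at h1
    linarith
  rw [hgram]
  have h7 : dist ((rayFrom y ξ).1 t) ((rayFrom y η).1 t) ^ 2 ≤ (t * √(2 - 2 * k)) ^ 2 := by
    gcongr
  rw [mul_pow, Real.sq_sqrt h2k] at h7
  linarith

theorem titsAngle_le_of_le_gram {x : X} {ξ η : Boundary X} {r : ℝ} (h₀ : 0 ≤ r) (h₁ : r ≤ Real.pi)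
    (hk : ∀ t : ℝ≥0,
      2 * Real.cos r * (t : ℝ) ^ 2 ≤ gram x ((rayFrom x ξ).1 t) ((rayFrom x η).1 t)) :
    titsAngle ξ η ≤ r := by
  have : Nonempty X := ⟨x⟩
  refine ciSup_le fun y => limsup_le_of_le (isCoboundedUnder_comparisonAngle _ _ _) ?_
  filter_upwards [eventually_pos_prod] with q hq
  have h1 := GeodesicRay.le_gram_of_forall hX (rayFrom_zero hX y ξ) (rayFrom_zero hX y η)
    (le_gram_rayFrom_of_le_gram hX y hk) q.1 q.2
  rw [comparisonAngle_eq, dist_rayFrom hX, dist_rayFrom hX]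
  have hq1 : (0 : ℝ) < q.1 := hq.1
  have hq2 : (0 : ℝ) < q.2 := hq.2
  rw [← Real.arccos_cos h₀ h₁]
  apply Real.arccos_le_arccos
  rw [le_div_iff₀ (by positivity)]
  linarith

/-- The Busemann function of `η` controls the distance to the rays towards `η`. -/
theorem busemann_sub_add_le_dist (x p y : X) (η : Boundary X) (t : ℝ≥0) :
    t + (busemann x η y - busemann x η p) ≤ dist y ((rayFrom p η).1 t) := by
  obtain ⟨U, hU⟩ := exists_ultrafilter_atTop
  have h1 := tendsto_geodesic_rayFrom hX p (rayFrom x η) hU t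
  rw [endpoint_rayFrom hX] at h1
  have h2 := (tendsto_busemann hX x η y).mono_left hU
  have h3 := (tendsto_busemann hX x η p).mono_left hU
  refine le_of_tendsto_of_tendsto ((h2.sub h3).const_add (t : ℝ)) (tendsto_const_nhds.dist h1) ?_
  -- This makes the geodesic from `p` to the point at time `s` at least `t` long, so that its point
  -- at time `t` is meaningful.
  have h4 : ∀ᶠ s : ℝ≥0 in U, (t : ℝ) + dist x p ≤ s :=
    hU ((NNReal.tendsto_coe_atTop.2 tendsto_id).eventually_ge_atTop _)
  filter_upwards [h4] with s hs
  have h5 : (t : ℝ) ≤ dist p ((rayFrom x η).1 s) := by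
    have := dist_triangle x p ((rayFrom x η).1 s)
    rw [dist_rayFrom hX] at this
    linarith
  have h6 := hX.dist_geodesic_right p ((rayFrom x η).1 s) ⟨t.coe_nonneg, h5⟩
  have h7 := dist_triangle y (hX.geodesic p ((rayFrom x η).1 s) t) ((rayFrom x η).1 s)
  linarith

/-- For s ≥ t, monotonicity of comparison angles bounds the inner product at times (t, s) by s/t
times that at (t, t), called g. The law of cosines and |g| ≤ 2t² then give distance at least s -
g/(2t); let s tend to infinity. -/
theorem neg_gram_le_busemann (x : X) (ξ η : Boundary X) (t : ℝ≥0) :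
    -gram x ((rayFrom x ξ).1 t) ((rayFrom x η).1 t) ≤
      2 * t * busemann x η ((rayFrom x ξ).1 t) := by
  rcases (zero_le (a := t)).eq_or_lt with rfl | ht
  · simp [gram, rayFrom_zero hX]
  have ht' : (0 : ℝ) < t := ht
  set g := gram x ((rayFrom x ξ).1 t) ((rayFrom x η).1 t) with hg
  suffices -g / (2 * t) ≤ busemann x η ((rayFrom x ξ).1 t) by
    rwa [div_le_iff₀ (by positivity), mul_comm] at this
  refine ge_of_tendsto (tendsto_busemann hX x η _) ?_
  filter_upwards [eventually_ge_atTop t] with s hs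
  have hs' : (t : ℝ) ≤ s := hs
  have h1 := GeodesicRay.mul_mul_gram_le hX (rayFrom_zero hX x ξ) (rayFrom_zero hX x η)
    (le_refl t) hs
  rw [div_self ht'.ne', one_mul] at h1
  have h2 := gram_le x ((rayFrom x ξ).1 t) ((rayFrom x η).1 t)
  have h3 := le_gram x ((rayFrom x ξ).1 t) ((rayFrom x η).1 t)
  rw [dist_rayFrom hX, dist_rayFrom hX, ← hg] at h2 h3
  have h4 : s / t * ((t : ℝ) / s * gram x ((rayFrom x ξ).1 t) ((rayFrom x η).1 s)) ≤ s / t * g := by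
    gcongr
  have hs0 : (0 : ℝ) < s := ht'.trans_le hs'
  have h5 : s / t * ((t : ℝ) / s * gram x ((rayFrom x ξ).1 t) ((rayFrom x η).1 s)) =
      gram x ((rayFrom x ξ).1 t) ((rayFrom x η).1 s) := by field_simp
  rw [h5, gram, dist_rayFrom hX, dist_rayFrom hX] at h4
  have h6 : (g / (2 * t)) ^ 2 ≤ (t : ℝ) ^ 2 := by
    apply sq_le_sq.2
    rw [abs_of_pos ht', abs_le, le_div_iff₀ (by positivity), div_le_iff₀ (by positivity)]
    constructor <;> nlinarith
  have h7 : s - g / (2 * t) ≤ dist ((rayFrom x ξ).1 t) ((rayFrom x η).1 s) := by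
    refine le_of_sq_le_sq ?_ dist_nonneg
    have : ((s : ℝ) - g / (2 * t)) ^ 2 = s ^ 2 - s / t * g + (g / (2 * t)) ^ 2 := by
      field_simp; ring
    linarith
  rw [neg_div]
  linarith

/-- Let k be the cosine of the comparison angle at time t, and move the base point to `p`, the point
at time t of the ray to ξ. The Busemann function of η vanishes at x and is at least -kt at `p`, so
by convexity it has slope at least -k beyond `p`. This forces the Alexandrov angle at `p` to be at
least arccos k. -/
theorem le_gram_of_titsAngle_le (x : X) {ξ η : Boundary X} {r : ℝ}
    (h₁ : r ≤ Real.pi) (h : titsAngle ξ η ≤ r) (t : ℝ≥0) :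
    2 * Real.cos r * (t : ℝ) ^ 2 ≤ gram x ((rayFrom x ξ).1 t) ((rayFrom x η).1 t) := by
  rcases (zero_le (a := t)).eq_or_lt with rfl | ht
  · simp [gram, rayFrom_zero hX]
  have ht' : (0 : ℝ) < t := ht
  set g := gram x ((rayFrom x ξ).1 t) ((rayFrom x η).1 t) with hg
  set k := g / (2 * (t : ℝ) ^ 2) with hkdef
  have hgk : g = 2 * k * (t : ℝ) ^ 2 := by rw [hkdef]; field_simp
  have hk : -1 ≤ k ∧ k ≤ 1 := by
    have h2 := gram_le x ((rayFrom x ξ).1 t) ((rayFrom x η).1 t)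
    have h3 := le_gram x ((rayFrom x ξ).1 t) ((rayFrom x η).1 t)
    rw [dist_rayFrom hX, dist_rayFrom hX, ← hg] at h2 h3
    rw [hkdef, le_div_iff₀ (by positivity), div_le_iff₀ (by positivity)]
    constructor <;> nlinarith
  set p := (rayFrom x ξ).1 t with hp
  have hB : -(k * t) ≤ busemann x η p := by
    have := neg_gram_le_busemann hX x ξ η t
    rw [← hg, hgk] at this
    nlinarith
  have hbus : ∀ e : ℝ≥0,
      -(k * e) ≤ busemann x η ((rayFrom x ξ).1 (t + e)) - busemann x η p := by
    intro e
    have h1 := ((rayFrom x ξ).isDivisionPoint_zero (s := t) (t := t + e) (by simp)).busemann_le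
      hX x η
    rw [rayFrom_zero hX, busemann_base hX, mul_zero, zero_add, ← hp] at h1
    push_cast at h1
    rw [div_mul_eq_mul_div, le_div_iff₀ (by positivity)] at h1
    have he : (0 : ℝ) ≤ e := e.2
    have : e * -(k * t) ≤ e * busemann x η p := by gcongr
    nlinarith
  -- The opposite side is at least d - ke, so by the law of cosines the cosine is at most (e² + 2kde
  -- - k²e²)/(2ed) ≤ k + e/(2d).
  have hangle : ∀ e d : ℝ≥0, 0 < e → e ≤ d → Real.arccos (k + e / (2 * d)) ≤
      comparisonAngle p ((rayFrom p ξ).1 e) ((rayFrom p η).1 d) := by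
    intro e d he hed
    have he' : (0 : ℝ) < e := he
    have hed' : (e : ℝ) ≤ d := hed
    have hd' : (0 : ℝ) < d := he'.trans_le hed'
    rw [comparisonAngle_eq]
    apply Real.arccos_le_arccos
    have h1 := busemann_sub_add_le_dist hX x p ((rayFrom x ξ).1 (t + e)) η d
    have h2 := hbus e
    have h3 : (rayFrom x ξ).1 (t + e) = (rayFrom p ξ).1 e := by
      rw [hp, rayFrom_rayFrom hX]; rfl
    rw [h3] at h1 h2
    have h4 : d - k * e ≤ dist ((rayFrom p ξ).1 e) ((rayFrom p η).1 d) := by linarith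
    have h5 : 0 ≤ (d : ℝ) - k * e := by nlinarith
    have h6 : ((d : ℝ) - k * e) ^ 2 ≤ dist ((rayFrom p ξ).1 e) ((rayFrom p η).1 d) ^ 2 := by
      gcongr
    rw [dist_rayFrom hX, dist_rayFrom hX, div_le_iff₀ (by positivity), gram, dist_rayFrom hX,
      dist_rayFrom hX]
    have h7 : (k + (e : ℝ) / (2 * d)) * (2 * e * d) = 2 * k * e * d + e ^ 2 := by
      field_simp
    rw [h7]
    nlinarith [mul_nonneg (sq_nonneg k) (sq_nonneg (e : ℝ))]
  have hlim := arccos_le_alexandrovAngle hangle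
  have hr : Real.arccos k ≤ r := hlim.trans ((alexandrovAngle_le_titsAngle p ξ η).trans h)
  have hcos := Real.cos_le_cos_of_nonneg_of_le_pi (Real.arccos_nonneg k) h₁ hr
  rw [Real.cos_arccos hk.1 hk.2] at hcos
  rw [hgk]
  gcongr

/-- The metric description of the angular metric, from any base point. -/
theorem titsAngle_le_iff (x : X) {ξ η : Boundary X} {r : ℝ} (h₀ : 0 ≤ r) (h₁ : r ≤ Real.pi) :
    titsAngle ξ η ≤ r ↔ ∀ t : ℝ≥0,
      2 * Real.cos r * (t : ℝ) ^ 2 ≤ gram x ((rayFrom x ξ).1 t) ((rayFrom x η).1 t) :=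
  ⟨le_gram_of_titsAngle_le hX x h₁, titsAngle_le_of_le_gram hX h₀ h₁⟩

end Angles

/-! ### Circumradius and circumcenters -/

section Circumcenters

variable {X : Type*} [MetricSpace X]

theorem bddBelow_circumradius (A : Set (Boundary X)) :
    BddBelow {r : ℝ | 0 < r ∧ ∃ ξ : Boundary X, ∀ η ∈ A, titsAngle ξ η ≤ r} :=
  ⟨0, fun _ h => h.1.le⟩

theorem circumradius_nonneg (A : Set (Boundary X)) : 0 ≤ circumradius A :=
  Real.sInf_nonneg fun _ h => h.1.le

/-- The infimum runs over positive radii only, so `r = 0` is reached through slightly larger radii.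
-/
theorem circumradius_le {A : Set (Boundary X)} {r : ℝ} (h₀ : 0 ≤ r) {ξ : Boundary X}
    (h : ∀ η ∈ A, titsAngle ξ η ≤ r) : circumradius A ≤ r :=
  le_of_forall_gt fun _ hr => (csInf_le (bddBelow_circumradius A)
    ⟨h₀.trans_lt (left_lt_add_div_two.2 hr), ξ, fun η hη =>
      (h η hη).trans (left_lt_add_div_two.2 hr).le⟩).trans_lt (add_div_two_lt_right.2 hr)

theorem circumradius_le_pi [Nonempty X] {A : Set (Boundary X)} (hA : A.Nonempty) :
    circumradius A ≤ Real.pi :=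
  circumradius_le Real.pi_pos.le (ξ := hA.some) fun η _ => titsAngle_le_pi _ η

theorem circumradius_lt_iff [Nonempty X] {A : Set (Boundary X)} (hA : A.Nonempty) {r : ℝ} :
    circumradius A < r ↔
      ∃ q : ℚ, 0 < (q : ℝ) ∧ (q : ℝ) < r ∧ ∃ ξ : Boundary X, ∀ η ∈ A, titsAngle ξ η ≤ q := by
  constructor
  · intro h
    obtain ⟨s, ⟨hs0, ξ, hξ⟩, hsr⟩ := (csInf_lt_iff (bddBelow_circumradius A)
      ⟨Real.pi, Real.pi_pos, hA.some, fun η _ => titsAngle_le_pi _ η⟩).1 h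
    obtain ⟨q, hq1, hq2⟩ := exists_rat_btwn hsr
    exact ⟨q, hs0.trans hq1, hq2, ξ, fun η hη => (hξ η hη).trans hq1.le⟩
  · rintro ⟨q, hq0, hqr, ξ, hξ⟩
    exact (circumradius_le hq0.le hξ).trans_lt hqr

/-! ### Existence and uniqueness of circumcenters -/

variable [ProperSpace X] (hX : IsCAT0 X)

include hX

/-- Points going to infinity in `X` which see the points of `A` under small comparison angles
accumulate at a boundary point which sees the points of `A` under small angles. -/
theorem exists_boundary_tendsto (x : X) (A : Set (Boundary X)) {ι : Type*} (U : Ultrafilter ι)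
    (z : ι → X) (hz : Tendsto (fun i => dist x (z i)) U atTop) {k : ι → ℝ} {k₀ : ℝ}
    (hk : Tendsto k U (𝓝 k₀))
    (hgram : ∀ η ∈ A, ∀ t : ℝ≥0, ∀ᶠ i in (U : Filter ι),
      2 * k i * dist x (z i) * t ≤ gram x (z i) ((rayFrom x η).1 t)) :
    ∃ ξ : Boundary X,
      (∀ t : ℝ≥0, Tendsto (fun i => hX.geodesic x (z i) t) U (𝓝 ((rayFrom x ξ).1 t))) ∧
      ∀ η ∈ A, ∀ t : ℝ≥0,
        2 * k₀ * (t : ℝ) ^ 2 ≤ gram x ((rayFrom x ξ).1 t) ((rayFrom x η).1 t) := by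
  obtain ⟨c, hc0, hc⟩ := hX.exists_ray_tendsto x U z hz
  have hray : rayFrom x c.endpoint = c := rayFrom_eq hX hc0 rfl
  refine ⟨c.endpoint, by rwa [hray], fun η hη t => ?_⟩
  rw [hray]
  have h1 : Tendsto (fun i => gram x (hX.geodesic x (z i) t) ((rayFrom x η).1 t)) U
      (𝓝 (gram x (c.1 t) ((rayFrom x η).1 t))) := by
    exact (((tendsto_const_nhds.dist (hc t)).pow 2).add tendsto_const_nhds).sub
      (((hc t).dist tendsto_const_nhds).pow 2)
  refine le_of_tendsto_of_tendsto ((hk.const_mul 2).mul_const _) h1 ?_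
  filter_upwards [hgram η hη t, hz.eventually_ge_atTop (t : ℝ), hz.eventually_gt_atTop 0]
    with i hi hti h0
  have ht := t.coe_nonneg
  have h2 : IsDivisionPoint (t / dist x (z i)) x (z i) (hX.geodesic x (z i) t) :=
    IsDivisionPoint.of_dist ht hti (hX.dist_geodesic_left x _ ⟨ht, hti⟩)
      (hX.dist_geodesic_right x _ ⟨ht, hti⟩)
  refine le_trans ?_ (h2.mul_gram_le hX _)
  calc 2 * k i * (t : ℝ) ^ 2 = t / dist x (z i) * (2 * k i * dist x (z i) * t) := by
        field_simp
    _ ≤ _ := by gcongr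

theorem isCircumcenter_iff (x : X) {A : Set (Boundary X)} (hA : A.Nonempty) {ξ : Boundary X} :
    IsCircumcenter A ξ ↔ ∀ η ∈ A, ∀ t : ℝ≥0, 2 * Real.cos (circumradius A) * (t : ℝ) ^ 2 ≤
      gram x ((rayFrom x ξ).1 t) ((rayFrom x η).1 t) := by
  have : Nonempty X := ⟨x⟩
  exact forall₂_congr fun η _ =>
    titsAngle_le_iff hX x (circumradius_nonneg A) (circumradius_le_pi hA)

theorem exists_isCircumcenter (x : X) {A : Set (Boundary X)} (hA : A.Nonempty) :
    ∃ ξ, IsCircumcenter A ξ := by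
  have hne : Nonempty X := ⟨x⟩
  set r := circumradius A with hr
  have hpos : ∀ n : ℕ, (0 : ℝ) < 1 / ((n : ℝ) + 1) := fun n => by positivity
  -- Almost optimal centres; the radii are cut off at π, where the cosine description stops.
  have hξ : ∀ n : ℕ, ∃ ξ : Boundary X, ∀ η ∈ A,
      titsAngle ξ η ≤ min (r + 1 / ((n : ℝ) + 1)) Real.pi := by
    intro n
    obtain ⟨q, -, hq, ξ, hξ⟩ := (circumradius_lt_iff hA).1 (lt_add_of_pos_right r (hpos n))
    exact ⟨ξ, fun η hη => le_min ((hξ η hη).trans hq.le) (titsAngle_le_pi ξ η)⟩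
  choose ξ hξ using hξ
  let U : Ultrafilter ℕ := Ultrafilter.of atTop
  have hU : (U : Filter ℕ) ≤ atTop := Ultrafilter.of_le atTop
  have hk : Tendsto (fun n : ℕ => Real.cos (min (r + 1 / ((n : ℝ) + 1)) Real.pi)) U
      (𝓝 (Real.cos r)) := by
    have h1 : Tendsto (fun n : ℕ => min (r + 1 / ((n : ℝ) + 1)) Real.pi) atTop
        (𝓝 (min (r + 0) Real.pi)) :=
      (tendsto_one_div_add_atTop_nhds_zero_nat.const_add r).min tendsto_const_nhds
    rw [add_zero, min_eq_left (circumradius_le_pi hA)] at h1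
    exact ((Real.continuous_cos.tendsto r).comp h1).mono_left hU
  obtain ⟨ζ, -, hζ⟩ := exists_boundary_tendsto hX x A U (fun n => (rayFrom x (ξ n)).1 n)
    (by
      refine (tendsto_natCast_atTop_atTop.mono_left hU).congr fun n => ?_
      rw [dist_rayFrom hX]; simp) hk fun η hη t => Eventually.of_forall fun n => by
    have h0 : 0 ≤ min (r + 1 / ((n : ℝ) + 1)) Real.pi :=
      le_min (add_nonneg (circumradius_nonneg A) (hpos n).le) Real.pi_pos.le
    have h1 := (titsAngle_le_iff hX x h0 (min_le_right _ _)).1 (hξ n η hη)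
    have h2 := GeodesicRay.le_gram_of_forall hX (rayFrom_zero hX x (ξ n)) (rayFrom_zero hX x η)
      h1 n t
    rwa [dist_rayFrom hX]
  exact ⟨ζ, (isCircumcenter_iff hX x hA).2 hζ⟩

/-- The midpoint `z` of the points at time `t` on two rays, whose endpoints have small angle with
`η`, has small comparison angles with `η`. -/
theorem IsDivisionPoint.le_gram_rayFrom {x z : X} {ξ ξ' η : Boundary X} {k : ℝ}
    (hξ : ∀ t : ℝ≥0, 2 * k * (t : ℝ) ^ 2 ≤ gram x ((rayFrom x ξ).1 t) ((rayFrom x η).1 t))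
    (hξ' : ∀ t : ℝ≥0, 2 * k * (t : ℝ) ^ 2 ≤ gram x ((rayFrom x ξ').1 t) ((rayFrom x η).1 t))
    {t : ℝ≥0} (hz : IsDivisionPoint (1 / 2) ((rayFrom x ξ).1 t) ((rayFrom x ξ').1 t) z)
    (s : ℝ≥0) : 2 * k * t * s ≤ gram x z ((rayFrom x η).1 s) := by
  -- Against the far point at time `T`, passing to the midpoint loses at most t² in the inner
  -- product; rescaling to time `s` turns the loss into st²/T.
  have hbd : ∀ T : ℝ≥0, 0 < T → s ≤ T →
      2 * k * t * s - s * t ^ 2 * (T : ℝ)⁻¹ ≤ gram x z ((rayFrom x η).1 s) := by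
    intro T hT hsT
    have hT' : (0 : ℝ) < T := hT
    have h1 := GeodesicRay.le_gram_of_forall hX (rayFrom_zero hX x ξ) (rayFrom_zero hX x η) hξ t T
    have h2 := GeodesicRay.le_gram_of_forall hX (rayFrom_zero hX x ξ') (rayFrom_zero hX x η)
      hξ' t T
    have h3 := hz.dist_sq_le hX ((rayFrom x η).1 T)
    rw [gram_comm, gram, dist_rayFrom hX, dist_rayFrom hX] at h1 h2
    have h4 : 2 * k * t * T - t ^ 2 ≤ gram x z ((rayFrom x η).1 T) := by
      rw [gram_comm, gram, dist_rayFrom hX]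
      nlinarith [sq_nonneg (dist x z),
        sq_nonneg (dist ((rayFrom x ξ).1 t) ((rayFrom x ξ').1 t))]
    have h5 := (rayFrom x η).isDivisionPoint_zero hsT
    rw [rayFrom_zero hX] at h5
    have h6 := h5.mul_gram_le hX z
    rw [gram_comm x _ z, gram_comm x _ z] at h6
    refine le_trans ?_ h6
    calc 2 * k * t * s - s * t ^ 2 * (T : ℝ)⁻¹ = (s : ℝ) / T * (2 * k * t * T - t ^ 2) := by
          field_simp
      _ ≤ _ := by gcongr
  have hlim : Tendsto (fun T : ℝ≥0 => 2 * k * t * s - s * t ^ 2 * (T : ℝ)⁻¹) atTop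
      (𝓝 (2 * k * t * s - s * t ^ 2 * 0)) := by
    have := tendsto_inv_atTop_zero.comp (NNReal.tendsto_coe_atTop.2 (tendsto_id (x := atTop)))
    exact (this.const_mul _).const_sub _
  rw [mul_zero, sub_zero] at hlim
  refine le_of_tendsto hlim ?_
  filter_upwards [eventually_gt_atTop 0, eventually_ge_atTop s] with T hT hsT
  exact hbd T hT hsT

/-- Distinct boundary points are separated linearly by their rays. -/
theorem exists_mul_le_dist_rayFrom (x : X) {ξ ξ' : Boundary X} (hne : ξ ≠ ξ') :
    ∃ δ : ℝ, 0 < δ ∧ ∃ t₀ : ℝ≥0, ∀ t : ℝ≥0, t₀ ≤ t →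
      δ * t ≤ dist ((rayFrom x ξ).1 t) ((rayFrom x ξ').1 t) := by
  obtain ⟨t₀, ht₀⟩ : ∃ t, (rayFrom x ξ).1 t ≠ (rayFrom x ξ').1 t := by
    by_contra! h
    have h1 : rayFrom x ξ = rayFrom x ξ' := Subtype.ext (funext h)
    exact hne (by rw [← endpoint_rayFrom hX x ξ, h1, endpoint_rayFrom hX])
  have hpos : 0 < t₀ := by
    rw [pos_iff_ne_zero]
    rintro rfl
    exact ht₀ (by rw [rayFrom_zero hX, rayFrom_zero hX])
  have hpos' : (0 : ℝ) < t₀ := hpos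
  refine ⟨dist ((rayFrom x ξ).1 t₀) ((rayFrom x ξ').1 t₀) / t₀, div_pos (dist_pos.2 ht₀) hpos', t₀,
    fun t ht => ?_⟩
  have h1 := GeodesicRay.mul_dist_le hX (c := rayFrom x ξ) (c' := rayFrom x ξ')
    (by rw [rayFrom_zero hX, rayFrom_zero hX]) ht
  rw [div_mul_eq_mul_div, div_le_iff₀ hpos']
  linarith

theorem IsCircumcenter.unique (x : X) {A : Set (Boundary X)} (hA : A.Nonempty)
    (hr : circumradius A < Real.pi / 2) {ξ ξ' : Boundary X} (hξ : IsCircumcenter A ξ)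
    (hξ' : IsCircumcenter A ξ') : ξ = ξ' := by
  by_contra hne
  set r := circumradius A with hrdef
  have hr0 : 0 ≤ r := circumradius_nonneg A
  set k := Real.cos r with hkdef
  have hk : 0 < k := Real.cos_pos_of_mem_Ioo ⟨by linarith [Real.pi_pos], hr⟩
  rw [isCircumcenter_iff hX x hA] at hξ hξ'
  obtain ⟨δ, hδ, t₀, hδt⟩ := exists_mul_le_dist_rayFrom hX x hne
  -- The height of the Euclidean isosceles triangle with legs 1 and base `δ`: midpoints at time t
  -- lie within `w * t` of `x`, and their cosines rise from `k` to at least `k / w`.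
  set w := √(1 - δ ^ 2 / 4) with hw
  let z : ℝ≥0 → X := fun t => hX.geodesic ((rayFrom x ξ).1 t) ((rayFrom x ξ').1 t)
    (1 / 2 * dist ((rayFrom x ξ).1 t) ((rayFrom x ξ').1 t))
  have hz : ∀ t, IsDivisionPoint (1 / 2) ((rayFrom x ξ).1 t) ((rayFrom x ξ').1 t) (z t) :=
    fun t => hX.isDivisionPoint_geodesic _ _ (by norm_num) (by norm_num)
  have hgram : ∀ η ∈ A, ∀ t s : ℝ≥0, 2 * k * t * s ≤ gram x (z t) ((rayFrom x η).1 s) :=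
    fun η hη t s => (hz t).le_gram_rayFrom hX (hξ η hη) (hξ' η hη) s
  -- The midpoints go to infinity because `k > 0`, which is where the radius below π/2 enters.
  have hlow : ∀ t : ℝ≥0, k * t ≤ dist x (z t) := fun t => by
    obtain ⟨η, hη⟩ := hA
    have h1 := hgram η hη t 1
    have h2 := gram_le x (z t) ((rayFrom x η).1 1)
    rw [dist_rayFrom hX] at h2
    push_cast at h1 h2
    linarith
  have hup : ∀ t : ℝ≥0, t₀ ≤ t → dist x (z t) ^ 2 ≤ (1 - δ ^ 2 / 4) * (t : ℝ) ^ 2 := by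
    intro t ht
    have h1 := (hz t).dist_sq_le hX x
    rw [dist_rayFrom hX, dist_rayFrom hX] at h1
    have h2 : (δ * t) ^ 2 ≤ dist ((rayFrom x ξ).1 t) ((rayFrom x ξ').1 t) ^ 2 := by
      gcongr; exact hδt t ht
    linarith
  have hδ2 : 0 < 1 - δ ^ 2 / 4 := by
    have h1 := hup (t₀ + 1) (by simp)
    have h2 := hlow (t₀ + 1)
    have h3 : (0 : ℝ) < (t₀ + 1 : ℝ≥0) := by positivity
    have h4 : 0 < dist x (z (t₀ + 1)) := (mul_pos hk h3).trans_le h2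
    exact pos_of_mul_pos_left ((pow_pos h4 2).trans_le h1) (by positivity)
  have hw0 : 0 < w := Real.sqrt_pos.2 hδ2
  have hw1 : w < 1 := (Real.sqrt_lt' one_pos).2 (by nlinarith)
  obtain ⟨U, hU⟩ := exists_ultrafilter_atTop
  obtain ⟨ζ, -, hζ⟩ := exists_boundary_tendsto hX x A U z
    (tendsto_atTop_mono hlow (((NNReal.tendsto_coe_atTop.2 tendsto_id).const_mul_atTop hk).mono_left
      hU)) (k := fun _ => k / w) tendsto_const_nhds fun η hη s => by
    filter_upwards [hU (eventually_ge_atTop t₀)] with t ht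
    refine le_trans ?_ (hgram η hη t s)
    have h1 : dist x (z t) ≤ w * t := by
      refine le_of_sq_le_sq ?_ (by positivity)
      rw [mul_pow, hw, Real.sq_sqrt hδ2.le]
      exact hup t ht
    calc 2 * (k / w) * dist x (z t) * s ≤ 2 * (k / w) * (w * t) * s := by gcongr
      _ = 2 * k * t * s := by field_simp
  have hkw : k < k / w := by rw [lt_div_iff₀ hw0]; nlinarith
  have hkw1 : k / w ≤ 1 := by
    obtain ⟨η, hη⟩ := hA
    have h1 := hζ η hη 1
    have h2 := gram_le x ((rayFrom x ζ).1 1) ((rayFrom x η).1 1)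
    rw [dist_rayFrom hX, dist_rayFrom hX] at h2
    push_cast at h1 h2
    linarith
  have hle : r ≤ Real.arccos (k / w) := by
    refine circumradius_le (Real.arccos_nonneg _) (ξ := ζ) fun η hη => ?_
    rw [titsAngle_le_iff hX x (Real.arccos_nonneg _) (Real.arccos_le_pi _),
      Real.cos_arccos (by linarith) hkw1]
    exact hζ η hη
  have hlt : Real.arccos (k / w) < Real.arccos k :=
    Real.strictAntiOn_arccos ⟨by linarith, by linarith⟩ ⟨by linarith, hkw1⟩ hkw
  rw [hkdef, Real.arccos_cos hr0 (by linarith [Real.pi_pos])] at hlt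
  linarith

end Circumcenters

/-! ### Measurability -/

/-- In a proper space, a continuous function with bounded sublevel sets takes a nonpositive value
if and only if it takes almost nonpositive values on a dense set. -/
theorem exists_le_zero_iff_forall_exists_lt {Y : Type*} [PseudoMetricSpace Y] [ProperSpace Y]
    {ι : Type*} {D : ι → Y} (hD : DenseRange D) {h : Y → ℝ} (hc : Continuous h)
    (hb : Bornology.IsBounded {p | h p ≤ 1}) :
    (∃ p, h p ≤ 0) ↔ ∀ j : ℕ, ∃ m, h (D m) < 1 / ((j : ℝ) + 1) := by
  constructor
  · rintro ⟨p, hp⟩ j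
    exact hD.exists_mem_open (isOpen_lt hc continuous_const) ⟨p, hp.trans_lt (by positivity)⟩
  · intro H
    have hK : IsCompact {p | h p ≤ 1} :=
      Metric.isCompact_of_isClosed_isBounded (isClosed_le hc continuous_const) hb
    obtain ⟨m, hm⟩ := H 0
    obtain ⟨p, -, hp⟩ := hK.exists_isMinOn ⟨D m, by simpa using hm.le⟩ hc.continuousOn
    refine ⟨p, ge_of_tendsto' tendsto_one_div_add_atTop_nhds_zero_nat fun j => ?_⟩
    obtain ⟨m, hm⟩ := H j
    have hj : 1 / ((j : ℝ) + 1) ≤ 1 := by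
      rw [div_le_one (by positivity)]; linarith [j.cast_nonneg (α := ℝ)]
    exact (hp (show h (D m) ≤ 1 from hm.le.trans hj)).trans hm.le

theorem measurableSet_exists_le_zero {Ω : Type*} [MeasurableSpace Ω] {Y : Ω → Type*}
    [∀ ω, PseudoMetricSpace (Y ω)] (hY : ∀ ω, ProperSpace (Y ω)) {ι : Type*} [Countable ι]
    {D : ι → ∀ ω, Y ω} (hD : ∀ ω, DenseRange fun i => D i ω) {h : ∀ ω, Y ω → ℝ}
    (hc : ∀ ω, Continuous (h ω)) (hb : ∀ ω, Bornology.IsBounded {p | h ω p ≤ 1})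
    (hm : ∀ i, Measurable fun ω => h ω (D i ω)) : MeasurableSet {ω | ∃ p, h ω p ≤ 0} := by
  have : {ω | ∃ p, h ω p ≤ 0} = ⋂ j : ℕ, ⋃ i, {ω | h ω (D i ω) < 1 / ((j : ℝ) + 1)} := by
    ext ω
    simp only [mem_ofPred_eq, mem_iInter, mem_iUnion]
    exact exists_le_zero_iff_forall_exists_lt (hD ω) (hc ω) (hb ω)
  rw [this]
  exact MeasurableSet.iInter fun j => MeasurableSet.iUnion fun i =>
    measurableSet_lt (hm i) measurable_const

/-! ### Boundary points tested on dense sequences and at finite distances -/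

section Pointwise

variable {X : Type*} [MetricSpace X]

/-- The angular balls are closed in the cone topology, so that they contain a set as soon as they
contain a dense sequence of it. -/
theorem forall_le_gram_iff (x₀ : X) {A : Set (Boundary X)} {y : ℕ → Boundary X}
    (hy : ∀ n, y n ∈ A) (hA : A ⊆ closure[coneTopology x₀] (range y)) (ξ : Boundary X) (k : ℝ) :
    (∀ η ∈ A, ∀ t : ℝ≥0,
      2 * k * (t : ℝ) ^ 2 ≤ gram x₀ ((rayFrom x₀ ξ).1 t) ((rayFrom x₀ η).1 t)) ↔
    ∀ (i : ℕ) (t : ℝ≥0),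
      2 * k * (t : ℝ) ^ 2 ≤ gram x₀ ((rayFrom x₀ ξ).1 t) ((rayFrom x₀ (y i)).1 t) := by
  refine ⟨fun h i => h _ (hy i), fun h => ?_⟩
  have hcl : IsClosed {f : ℝ≥0 → X | ∀ t : ℝ≥0,
      2 * k * (t : ℝ) ^ 2 ≤ gram x₀ ((rayFrom x₀ ξ).1 t) (f t)} := by
    simp only [ofPred_forall, gram]
    exact isClosed_iInter fun t => isClosed_le continuous_const (by fun_prop)
  have hcl' : IsClosed[coneTopology x₀] {η : Boundary X | ∀ t : ℝ≥0,
      2 * k * (t : ℝ) ^ 2 ≤ gram x₀ ((rayFrom x₀ ξ).1 t) ((rayFrom x₀ η).1 t)} :=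
    isClosed_induced_iff.2 ⟨_, hcl, rfl⟩
  let _ : TopologicalSpace (Boundary X) := coneTopology x₀
  exact fun η hη => closure_minimal (range_subset_iff.2 h) hcl' (hA hη)

variable [ProperSpace X] (hX : IsCAT0 X)

include hX

/-- The point at time `t` of a ray minimizes the Busemann function on the ball of radius `t`. -/
theorem eq_rayFrom_of_busemann_le (x : X) (ξ : Boundary X) {t : ℝ≥0} {p : X}
    (h₁ : busemann x ξ p ≤ -t) (h₂ : dist x p ≤ t) : p = (rayFrom x ξ).1 t := by
  -- At the midpoint the Busemann value is still at most -t, so its distance to `x` is at least t;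
  -- Stewart's inequality makes it smaller unless the two points coincide.
  have hq := hX.isDivisionPoint_geodesic p ((rayFrom x ξ).1 t) (m := 1 / 2) (by norm_num)
    (by norm_num)
  have h3 := hq.busemann_le hX x ξ
  have h4 := hq.dist_sq_le hX x
  rw [busemann_ray hX] at h3
  rw [dist_rayFrom hX] at h4
  have h5 := neg_dist_le_busemann hX x ξ
    (hX.geodesic p ((rayFrom x ξ).1 t) (1 / 2 * dist p ((rayFrom x ξ).1 t)))
  have h6 : (t : ℝ) ≤ dist x
    (hX.geodesic p ((rayFrom x ξ).1 t) (1 / 2 * dist p ((rayFrom x ξ).1 t))) := by linarith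
  have h7 : (t : ℝ) ^ 2 ≤ dist x
    (hX.geodesic p ((rayFrom x ξ).1 t) (1 / 2 * dist p ((rayFrom x ξ).1 t))) ^ 2 := by gcongr
  have h8 : dist x p ^ 2 ≤ (t : ℝ) ^ 2 := by gcongr
  have h9 : dist p ((rayFrom x ξ).1 t) ^ 2 ≤ 0 := by linarith
  exact dist_eq_zero.1 (pow_eq_zero_iff two_ne_zero |>.1 (le_antisymm h9 (by positivity)))

/-- The existence of a boundary point seen under small angles with prescribed boundary points
`y i`, and whose ray passes close to a point, can be checked at each distance `N`. -/
theorem exists_boundary_iff (x₀ x : X) (y : ℕ → Boundary X) (k a : ℝ) (n : ℝ≥0) :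
    (∃ ξ : Boundary X, dist x ((rayFrom x₀ ξ).1 n) ≤ a ∧ ∀ (i : ℕ) (t : ℝ≥0),
      2 * k * (t : ℝ) ^ 2 ≤ gram x₀ ((rayFrom x₀ ξ).1 t) ((rayFrom x₀ (y i)).1 t)) ↔
    ∀ N : ℕ, n ≤ N → ∃ p : X × X, dist x₀ p.1 = n ∧ dist p.1 p.2 = N - n ∧ dist x₀ p.2 = N ∧
      dist x p.1 ≤ a ∧ ∀ i < N,
        2 * k * (N : ℝ) ^ 2 ≤ gram x₀ p.2 ((rayFrom x₀ (y i)).1 N) := by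
  constructor
  · rintro ⟨ξ, ha, hξ⟩ N hN
    refine ⟨((rayFrom x₀ ξ).1 n, (rayFrom x₀ ξ).1 N), dist_rayFrom hX _ _ _, ?_, ?_, ha,
      fun i _ => by simpa using hξ i N⟩
    · have hN' : (n : ℝ) ≤ N := by exact_mod_cast hN
      rw [GeodesicRay.dist_eq, abs_sub_comm, abs_of_nonneg (by simpa using hN')]
      simp
    · rw [dist_rayFrom hX]; simp
  · intro H
    have H' : ∀ N : ℕ, ∃ p : X × X, n ≤ N → dist x₀ p.1 = n ∧ dist p.1 p.2 = N - n ∧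
        dist x₀ p.2 = N ∧ dist x p.1 ≤ a ∧
        ∀ i < N, 2 * k * (N : ℝ) ^ 2 ≤ gram x₀ p.2 ((rayFrom x₀ (y i)).1 N) := fun N => by
      by_cases hN : n ≤ N
      · obtain ⟨p, hp⟩ := H N hN
        exact ⟨p, fun _ => hp⟩
      · exact ⟨(x, x), fun h => absurd h hN⟩
    choose p hp using H'
    let U : Ultrafilter ℕ := Ultrafilter.of atTop
    have hU : (U : Filter ℕ) ≤ atTop := Ultrafilter.of_le atTop
    have hge : ∀ t : ℝ≥0, ∀ᶠ N : ℕ in U, t ≤ N := fun t =>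
      hU (tendsto_natCast_atTop_atTop.eventually_ge_atTop t)
    have hz : Tendsto (fun N => dist x₀ (p N).2) U atTop := by
      refine (tendsto_natCast_atTop_atTop.mono_left hU).congr' ?_
      filter_upwards [hge n] with N hN using (hp N hN).2.2.1.symm
    obtain ⟨ξ, hlim, hξ⟩ := exists_boundary_tendsto hX x₀ (range y) U (fun N => (p N).2) hz
      (k := fun _ => k) tendsto_const_nhds (by
        rintro _ ⟨i, rfl⟩ t
        -- At distance `N` only the indices below `N` are tested; each fixed `i` is eventually among
        -- them.
        filter_upwards [hge n, hge t, hge (i + 1)] with N hnN htN hiN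
        have hiN' : i < N := by exact_mod_cast hiN
        have hN0 : (0 : ℝ) < N := by exact_mod_cast (Nat.zero_le i).trans_lt hiN'
        obtain ⟨-, -, h3, -, h5⟩ := hp N hnN
        have h6 := (rayFrom x₀ (y i)).isDivisionPoint_zero htN
        rw [rayFrom_zero hX] at h6
        have h7 := h6.mul_gram_le hX (p N).2
        rw [gram_comm x₀ _ (p N).2, gram_comm x₀ _ (p N).2, NNReal.coe_natCast] at h7
        refine le_trans ?_ h7
        rw [h3]
        calc 2 * k * N * t = t / N * (2 * k * (N : ℝ) ^ 2) := by field_simp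
          _ ≤ _ := by gcongr; exact h5 i hiN')
    refine ⟨ξ, le_of_tendsto (tendsto_const_nhds.dist (hlim n)) ?_, fun i t => hξ _ ⟨i, rfl⟩ t⟩
    filter_upwards [hge n, hge 1] with N hnN h1N
    obtain ⟨h1, h2, h3, h4, -⟩ := hp N hnN
    have hnN' : (n : ℝ) ≤ N := by exact_mod_cast hnN
    have hN0 : (N : ℝ) ≠ 0 := by
      have : 1 ≤ N := by exact_mod_cast h1N
      positivity
    -- The three distance equations place `p.1` on the geodesic from `x₀` to `p.2` at time `n`, so
    -- its distance bound passes to the limit ray.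
    have h5 := (IsDivisionPoint.of_dist n.coe_nonneg (hnN'.trans_eq h3.symm) h1
      (h2.trans (by rw [h3]))).eq_geodesic hX
    rw [h3, div_mul_cancel₀ _ hN0] at h5
    rwa [← h5]

end Pointwise

/-! ### Measurability over the field -/

section Fields

variable {Ω : Type*} [MeasurableSpace Ω] {X : Ω → Type*} [∀ ω, MetricSpace (X ω)]
  (hproper : ∀ ω, ProperSpace (X ω)) (hcat : ∀ ω, IsCAT0 (X ω))
  {L : Set (∀ ω, X ω)} (hL : IsBorelStructure L) {x₀ : ∀ ω, X ω} (hx₀ : x₀ ∈ L)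

include hproper hcat hL hx₀

/-- The points of the rays towards a Borel section of the field of boundaries form Borel
sections. -/
theorem rayFrom_mem_of_mem_boundarySections {ξ : ∀ ω, Boundary (X ω)}
    (hξ : ξ ∈ boundarySections L x₀) (t : ℝ≥0) : (fun ω => (rayFrom (x₀ ω) (ξ ω)).1 t) ∈ L := by
  refine hL.maximal _ fun x hx => measurable_of_Iic fun a => ?_
  obtain ⟨D, hDL, hD⟩ := hL.separable
  -- The first two conditions on `p` single out the ray point, so the third is the required
  -- inequality at that point.
  have hset : (fun ω => dist (x ω) ((rayFrom (x₀ ω) (ξ ω)).1 t)) ⁻¹' Iic a =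
      {ω | ∃ p : X ω, max (busemann (x₀ ω) (ξ ω) p + t)
        (max (dist (x₀ ω) p - t) (dist (x ω) p - a)) ≤ 0} := by
    ext ω
    have := hproper ω
    simp only [mem_preimage, mem_Iic, mem_ofPred_eq, max_le_iff]
    constructor
    · intro h
      refine ⟨_, ?_, ?_, sub_nonpos.2 h⟩
      · rw [busemann_ray (hcat ω), neg_add_cancel]
      · rw [dist_rayFrom (hcat ω), sub_self]
    · rintro ⟨p, h1, h2, h3⟩
      rw [← eq_rayFrom_of_busemann_le (hcat ω) (x₀ ω) (ξ ω) (p := p) (t := t) (by linarith)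
        (by linarith)]
      linarith
  rw [hset]
  refine measurableSet_exists_le_zero hproper (D := D) (fun ω => dense_iff_closure_eq.2 (hD ω))
    (h := fun ω p => max (busemann (x₀ ω) (ξ ω) p + t)
      (max (dist (x₀ ω) p - t) (dist (x ω) p - a))) (fun ω => ?_) (fun ω => ?_) (fun i => ?_)
  · have := hproper ω
    have := continuous_busemann (hcat ω) (x₀ ω) (ξ ω)
    fun_prop
  · refine (Metric.isBounded_closedBall (x := x₀ ω) (r := t + 1)).subset fun p hp => ?_
    have h1 : dist (x₀ ω) p - t ≤ 1 := (le_max_left _ _).trans ((le_max_right _ _).trans hp)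
    rw [Metric.mem_closedBall, dist_comm]
    linarith
  · have h1 := hξ _ (hDL i)
    have h2 := hL.compatible _ hx₀ _ (hDL i)
    have h3 := hL.compatible _ hx _ (hDL i)
    exact (h1.add_const _).max ((h2.sub_const _).max (h3.sub_const _))

theorem measurableSet_exists_boundary {y : ℕ → ∀ ω, Boundary (X ω)}
    (hy : ∀ n, y n ∈ boundarySections L x₀) {k : Ω → ℝ} (hk : Measurable k) {x : ∀ ω, X ω}
    (hx : x ∈ L) (a : ℝ) (n : ℝ≥0) :
    MeasurableSet {ω | ∃ ξ : Boundary (X ω), dist (x ω) ((rayFrom (x₀ ω) ξ).1 n) ≤ a ∧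
      ∀ (i : ℕ) (t : ℝ≥0), 2 * k ω * (t : ℝ) ^ 2 ≤
        gram (x₀ ω) ((rayFrom (x₀ ω) ξ).1 t) ((rayFrom (x₀ ω) (y i ω)).1 t)} := by
  obtain ⟨D, hDL, hD⟩ := hL.separable
  -- The sum of the defects of the conditions at distance `N`: it is nonnegative and continuous,
  -- vanishes exactly when they all hold, and has bounded sublevel sets because both points have
  -- prescribed distances to `x₀`.
  let h : ℕ → ∀ ω, X ω × X ω → ℝ := fun N ω p =>
    |dist (x₀ ω) p.1 - n| + |dist p.1 p.2 - (N - n)| + |dist (x₀ ω) p.2 - N| +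
      max (dist (x ω) p.1 - a) 0 + ∑ i ∈ Finset.range N,
        max (2 * k ω * (N : ℝ) ^ 2 - gram (x₀ ω) p.2 ((rayFrom (x₀ ω) (y i ω)).1 N)) 0
  have hsum0 : ∀ N ω (p : X ω × X ω), 0 ≤ ∑ i ∈ Finset.range N,
      max (2 * k ω * (N : ℝ) ^ 2 - gram (x₀ ω) p.2 ((rayFrom (x₀ ω) (y i ω)).1 N)) 0 :=
    fun N ω p => Finset.sum_nonneg fun i _ => le_max_right _ _
  have hset : {ω | ∃ ξ : Boundary (X ω), dist (x ω) ((rayFrom (x₀ ω) ξ).1 n) ≤ a ∧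
      ∀ (i : ℕ) (t : ℝ≥0), 2 * k ω * (t : ℝ) ^ 2 ≤
        gram (x₀ ω) ((rayFrom (x₀ ω) ξ).1 t) ((rayFrom (x₀ ω) (y i ω)).1 t)} =
      ⋂ N : ℕ, ⋂ _ : n ≤ N, {ω | ∃ p, h N ω p ≤ 0} := by
    ext ω
    have := hproper ω
    simp only [mem_iInter]
    refine (exists_boundary_iff (hcat ω) (x₀ ω) (x ω) (fun i => y i ω) (k ω) a n).trans ?_
    refine forall₂_congr fun N _ => exists_congr fun p => ?_
    constructor
    · rintro ⟨h1, h2, h3, h4, h5⟩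
      have h6 : ∑ i ∈ Finset.range N,
          max (2 * k ω * (N : ℝ) ^ 2 - gram (x₀ ω) p.2 ((rayFrom (x₀ ω) (y i ω)).1 N)) 0 = 0 :=
        Finset.sum_eq_zero fun i hi =>
          max_eq_right (sub_nonpos.2 (h5 i (Finset.mem_range.1 hi)))
      simp [h, h1, h2, h3, h4, h6]
    · intro hp
      have h0 := hsum0 N ω p
      have h1 := abs_nonneg (dist (x₀ ω) p.1 - n)
      have h2 := abs_nonneg (dist p.1 p.2 - (N - n))
      have h3 := abs_nonneg (dist (x₀ ω) p.2 - N)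
      have h4 := le_max_right (dist (x ω) p.1 - a) 0
      have h4' := le_max_left (dist (x ω) p.1 - a) 0
      simp only [h] at hp
      refine ⟨sub_eq_zero.1 (abs_eq_zero.1 (by linarith)),
        sub_eq_zero.1 (abs_eq_zero.1 (by linarith)), sub_eq_zero.1 (abs_eq_zero.1 (by linarith)),
        by linarith, fun i hi => ?_⟩
      have h5 := Finset.single_le_sum (f := fun i => max (2 * k ω * (N : ℝ) ^ 2 -
        gram (x₀ ω) p.2 ((rayFrom (x₀ ω) (y i ω)).1 N)) 0) (fun i _ => le_max_right _ _)
        (Finset.mem_range.2 hi)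
      have h6 := le_max_left
        (2 * k ω * (N : ℝ) ^ 2 - gram (x₀ ω) p.2 ((rayFrom (x₀ ω) (y i ω)).1 N)) 0
      beta_reduce at h5
      linarith
  rw [hset]
  refine MeasurableSet.iInter fun N => MeasurableSet.iInter fun _ =>
    measurableSet_exists_le_zero (Y := fun ω => X ω × X ω) (fun ω => ?_)
      (D := fun (j : ℕ × ℕ) ω => (D j.1 ω, D j.2 ω)) (fun ω => ?_) (fun ω => ?_) (fun ω => ?_)
      (fun j => ?_)
  · have := hproper ω
    infer_instance
  · have hd : DenseRange fun m => D m ω := dense_iff_closure_eq.2 (hD ω)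
    exact hd.prodMap hd
  · simp only [h, gram]
    fun_prop
  · refine (Metric.isBounded_closedBall (x := (x₀ ω, x₀ ω)) (r := max (n + 1) (N + 1))).subset
      fun p hp => ?_
    simp only [h, mem_ofPred_eq] at hp
    have h0 := hsum0 N ω p
    have h1 := abs_nonneg (dist (x₀ ω) p.1 - n)
    have h2 := abs_nonneg (dist p.1 p.2 - (N - n))
    have h3 := abs_nonneg (dist (x₀ ω) p.2 - N)
    have h4 := le_max_right (dist (x ω) p.1 - a) 0
    have h5 := le_abs_self (dist (x₀ ω) p.1 - n)
    have h6 := le_abs_self (dist (x₀ ω) p.2 - N)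
    rw [Metric.mem_closedBall, dist_comm, Prod.dist_eq]
    exact max_le_max (by simp only; linarith) (by simp only; linarith)
  · have hd := hL.compatible
    have hr : ∀ i, (fun ω => (rayFrom (x₀ ω) (y i ω)).1 (N : ℝ≥0)) ∈ L := fun i =>
      rayFrom_mem_of_mem_boundarySections hproper hcat hL hx₀ (hy i) N
    have m1 := hd _ hx₀ _ (hDL j.1)
    have m2 := hd _ hx₀ _ (hDL j.2)
    have m3 := hd _ (hDL j.1) _ (hDL j.2)
    have m4 := hd _ hx _ (hDL j.1)
    have m5 : ∀ i, Measurable fun ω => gram (x₀ ω) (D j.2 ω)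
        ((rayFrom (x₀ ω) (y i ω)).1 (N : ℝ≥0)) := fun i =>
      ((m2.pow_const 2).add ((hd _ hx₀ _ (hr i)).pow_const 2)).sub
        ((hd _ (hDL j.2) _ (hr i)).pow_const 2)
    simp only [h]
    refine ((((?_ : Measurable _).add ?_).add ?_).add ?_).add
      (Finset.measurable_fun_sum _ fun i _ => ?_)
    · exact (m1.sub_const _).abs
    · exact (m3.sub_const _).abs
    · exact (m2.sub_const _).abs
    · exact (m4.sub_const _).max measurable_const
    · exact (((hk.const_mul 2).mul_const _).sub (m5 i)).max measurable_const

omit hx₀ in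
theorem mem_boundarySections_of_rayFrom_mem {ξ : ∀ ω, Boundary (X ω)}
    (hξ : ∀ n : ℕ, (fun ω => (rayFrom (x₀ ω) (ξ ω)).1 (n : ℝ≥0)) ∈ L) :
    ξ ∈ boundarySections L x₀ := by
  intro x hx
  refine measurable_of_tendsto_metrizable
    (fun n : ℕ => (hL.compatible _ hx _ (hξ n)).sub_const (n : ℝ)) ?_
  rw [tendsto_pi_nhds]
  intro ω
  have := hproper ω
  have h := (tendsto_busemann (hcat ω) (x₀ ω) (ξ ω) (x ω)).comp
    (tendsto_natCast_atTop_atTop (R := ℝ≥0))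
  exact h.congr fun n => by simp

theorem measurable_circumradius {A : ∀ ω, Set (Boundary (X ω))}
    (hA : IsBorelSubfield (fun ω => coneTopology (x₀ ω)) (boundarySections L x₀) A)
    (hAne : ∀ ω, (A ω).Nonempty) : Measurable fun ω => circumradius (A ω) := by
  obtain ⟨-, y, hy, hyA⟩ := hA
  refine measurable_of_Iio fun r => ?_
  -- At time 0 the condition on the ray is vacuous; the cut-off at π changes nothing, as no angle
  -- exceeds π.
  have hset : (fun ω => circumradius (A ω)) ⁻¹' Iio r =
      ⋃ q : ℚ, ⋃ _ : 0 < (q : ℝ), ⋃ _ : (q : ℝ) < r,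
        {ω | ∃ ξ : Boundary (X ω), dist (x₀ ω) ((rayFrom (x₀ ω) ξ).1 0) ≤ 0 ∧
          ∀ (i : ℕ) (t : ℝ≥0), 2 * Real.cos (min (q : ℝ) Real.pi) * (t : ℝ) ^ 2 ≤
            gram (x₀ ω) ((rayFrom (x₀ ω) ξ).1 t) ((rayFrom (x₀ ω) (y i ω)).1 t)} := by
    ext ω
    have := hproper ω
    have : Nonempty (X ω) := ⟨x₀ ω⟩
    simp only [mem_preimage, mem_Iio, mem_iUnion, exists_prop]
    refine (circumradius_lt_iff (hAne ω)).trans (exists_congr fun q => and_congr_right fun hq =>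
      and_congr_right fun _ => exists_congr fun ξ => ?_)
    rw [rayFrom_zero (hcat ω), dist_self, and_iff_right le_rfl,
      ← forall_le_gram_iff (x₀ ω) (hyA ω (hAne ω)).1 (hyA ω (hAne ω)).2 ξ]
    refine forall₂_congr fun η _ => ?_
    rw [← titsAngle_le_iff (hcat ω) (x₀ ω) (le_min hq.le Real.pi_pos.le) (min_le_right _ _),
      le_min_iff, and_iff_left (titsAngle_le_pi ξ η)]
  rw [hset]
  exact MeasurableSet.iUnion fun q => MeasurableSet.iUnion fun _ => MeasurableSet.iUnion fun _ =>
    measurableSet_exists_boundary hproper hcat hL hx₀ hy measurable_const hx₀ 0 0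

theorem circumcenter_mem_boundarySections {A : ∀ ω, Set (Boundary (X ω))}
    (hA : IsBorelSubfield (fun ω => coneTopology (x₀ ω)) (boundarySections L x₀) A)
    (hAne : ∀ ω, (A ω).Nonempty) (hr : ∀ ω, circumradius (A ω) < Real.pi / 2)
    {c : ∀ ω, Boundary (X ω)} (hc : ∀ ω, IsCircumcenter (A ω) (c ω)) :
    c ∈ boundarySections L x₀ := by
  have hmeas := measurable_circumradius hproper hcat hL hx₀ hA hAne
  obtain ⟨-, y, hy, hyA⟩ := hA
  refine mem_boundarySections_of_rayFrom_mem hproper hcat hL fun n =>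
    hL.maximal _ fun x hx => measurable_of_Iic fun a => ?_
  -- By uniqueness, a condition on the ray of `c ω` is the same as the existence of a circumcenter
  -- whose ray satisfies it.
  have hset : (fun ω => dist (x ω) ((rayFrom (x₀ ω) (c ω)).1 (n : ℝ≥0))) ⁻¹' Iic a =
      {ω | ∃ ξ : Boundary (X ω), dist (x ω) ((rayFrom (x₀ ω) ξ).1 n) ≤ a ∧
        ∀ (i : ℕ) (t : ℝ≥0), 2 * Real.cos (circumradius (A ω)) * (t : ℝ) ^ 2 ≤
          gram (x₀ ω) ((rayFrom (x₀ ω) ξ).1 t) ((rayFrom (x₀ ω) (y i ω)).1 t)} := by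
    ext ω
    have := hproper ω
    have hiff : ∀ ξ : Boundary (X ω), (∀ (i : ℕ) (t : ℝ≥0),
        2 * Real.cos (circumradius (A ω)) * (t : ℝ) ^ 2 ≤
          gram (x₀ ω) ((rayFrom (x₀ ω) ξ).1 t) ((rayFrom (x₀ ω) (y i ω)).1 t)) ↔
        IsCircumcenter (A ω) ξ := fun ξ => by
      rw [isCircumcenter_iff (hcat ω) (x₀ ω) (hAne ω),
        forall_le_gram_iff (x₀ ω) (hyA ω (hAne ω)).1 (hyA ω (hAne ω)).2]
    simp only [mem_preimage, mem_Iic, mem_ofPred_eq, hiff]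
    constructor
    · exact fun h => ⟨c ω, h, hc ω⟩
    · rintro ⟨ξ, h, hξ⟩
      rwa [(hc ω).unique (hcat ω) (x₀ ω) (hAne ω) (hr ω) hξ]
  rw [hset]
  exact measurableSet_exists_boundary hproper hcat hL hx₀ hy
    (Real.continuous_cos.measurable.comp hmeas) hx a n

end Fields

theorem mainTheorem6 {Ω : Type*} [MeasurableSpace Ω] {X : Ω → Type*} [∀ ω, MetricSpace (X ω)]
    (hproper : ∀ ω, ProperSpace (X ω)) (hcat : ∀ ω, IsCAT0 (X ω))
    (hunbdd : ∀ ω, ¬ Bornology.IsBounded (univ : Set (X ω)))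
    (L : Set (∀ ω, X ω)) (hL : IsBorelStructure L)
    (x₀ : ∀ ω, X ω) (hx₀ : x₀ ∈ L)
    (A : ∀ ω, Set (Boundary (X ω)))
    (hA : IsBorelSubfield (fun ω => coneTopology (x₀ ω)) (boundarySections L x₀) A)
    (hAne : ∀ ω, (A ω).Nonempty)
    (hAcl : ∀ ω, IsClosed[coneTopology (x₀ ω)] (A ω)) :
    (Measurable fun ω => circumradius (A ω)) ∧
    ((∀ ω, circumradius (A ω) < Real.pi / 2) →
      (∀ ω, ∃! ξ : Boundary (X ω), IsCircumcenter (A ω) ξ) ∧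
      ∀ c : ∀ ω, Boundary (X ω), (∀ ω, IsCircumcenter (A ω) (c ω)) →
        c ∈ boundarySections L x₀) := by
  refine ⟨measurable_circumradius hproper hcat hL hx₀ hA hAne, fun hr => ⟨fun ω => ?_, fun c hc =>
    circumcenter_mem_boundarySections hproper hcat hL hx₀ hA hAne hr hc⟩⟩
  have := hproper ω
  obtain ⟨ξ, hξ⟩ := exists_isCircumcenter (hcat ω) (x₀ ω) (hAne ω)
  exact ⟨ξ, hξ, fun ξ' hξ' => hξ'.unique (hcat ω) (x₀ ω) (hAne ω) (hr ω) hξ⟩
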